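/- Let $F$ be Thompson's group, i.e. the group of all orientation-preserving piecewise-linear homeomorphisms of $[0,1]$ that have finitely many breakpoints, all at dyadic rationals, and all of whose slopes are integral powers of $2$. For an open set $S\subseteq\mathbb R^2$, let $\mathrm{Homeo}^+(S)$ be the group of orientation-preserving homeomorphisms of $S$ and let $\mathrm{Mod}(S)$ be the group of homotopy classes of elements of $\mathrm{Homeo}^+(S)$. A group satisfies the classical Tits alternative if each of its subgroups either is virtually solvable or contains a nonabelian free group. Then: (1) $F$ is not virtually solvable and contains no nonabelian free group. (2) Let $\mathcal C\subseteq[0,1]\times\{0\}$ be any Cantor set (a subset homeomorphic to the middle-thirds Cantor set) and let $S=\mathbb R^2\setminus\mathcal C$. Then $F$ acts on $\mathbb R^2$ by homeomorphisms that fix every point outside the strip $[0,1]\times\mathbb R$ (and so map this strip onto itself) and map $\mathcal C$ onto itself, such that the action on $\mathcal C$ is faithful, every element of $F$ restricts to an orientation-preserving homeomorphism of $S$, and the resulting homomorphism $F\to\mathrm{Homeo}^+(S)\to\mathrm{Mod}(S)$ is injective. Moreover $\mathrm{Mod}(S)$ does not satisfy the classical Tits alternative. (3) If $\mathcal C$ is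 the middle-thirds Cantor set in $[0,1]\times\{0\}$, then the action in (2) can be chosen so that every element of $F$ acts on $\mathbb R^2$ by a piecewise-linear homeomorphism, i.e. one that is affine on each member of some locally finite cover of $\mathbb R^2$ by closed convex polyhedra. -/

import Mathlib

open scoped Topology unitInterval

/-! ### Group-theoretic notions -/

/-- A group is virtually solvable if it has a solvable subgroup of finite index. -/
def VirtuallySolvable (G : Type*) [Group G] : Prop :=
  ∃ N : Subgroup G, Group.IsSolvable N ∧ N.FiniteIndex

/-- A group contains a nonabelian free group; equivalently, it contains a free group of rank two,
since every nonabelian free group does. -/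
def ContainsNonabelianFree (G : Type*) [Group G] : Prop :=
  ∃ φ : FreeGroup (Fin 2) →* G, Function.Injective φ

/-- The classical Tits alternative: every subgroup is virtually solvable or contains a nonabelian
free group. -/
def ClassicalTitsAlternative (G : Type*) [Group G] : Prop :=
  ∀ H : Subgroup G, VirtuallySolvable H ∨ ContainsNonabelianFree H

/-! ### Thompson's group `F` -/

/-- A real number is a dyadic rational. -/
def IsDyadic (x : ℝ) : Prop := ∃ (m : ℤ) (n : ℕ), x = m / 2 ^ n

/-- `f` is piecewise affine with slopes integral powers of two, and all of its breakpoints lie in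
the finite set `D`: on every closed interval whose interior misses `D`, it is affine with slope a
power of two. -/
def HasDyadicBreaks (f : I ≃o I) (D : Finset I) : Prop :=
  ∀ a b : I, a < b → (∀ d ∈ D, d ∉ Set.Ioo a b) →
    ∃ k : ℤ, ∀ y ∈ Set.Icc a b, (f y : ℝ) - f a = (2 : ℝ) ^ k * ((y : ℝ) - a)

/-- `f` is a piecewise linear homeomorphism of `[0,1]` with finitely many breakpoints, all of them
dyadic rationals, and with slopes powers of two. -/
def IsThompson (f : I ≃o I) : Prop :=
  ∃ D : Finset I, (∀ d ∈ D, IsDyadic (d : ℝ)) ∧ HasDyadicBreaks f D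

theorem IsDyadic.add {x y : ℝ} (hx : IsDyadic x) (hy : IsDyadic y) : IsDyadic (x + y) := by
  obtain ⟨m, n, rfl⟩ := hx
  obtain ⟨p, q, rfl⟩ := hy
  refine ⟨m * 2 ^ q + p * 2 ^ n, n + q, ?_⟩
  push_cast
  rw [pow_add]
  field_simp

theorem IsDyadic.sub {x y : ℝ} (hx : IsDyadic x) (hy : IsDyadic y) : IsDyadic (x - y) := by
  obtain ⟨p, q, rfl⟩ := hy
  rw [sub_eq_add_neg]
  exact hx.add ⟨-p, q, by push_cast; ring⟩

theorem IsDyadic.zpow_mul {x : ℝ} (hx : IsDyadic x) (k : ℤ) : IsDyadic ((2 : ℝ) ^ k * x) := by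
  obtain ⟨m, n, rfl⟩ := hx
  obtain ⟨j, rfl | rfl⟩ := k.eq_nat_or_neg
  · exact ⟨2 ^ j * m, n, by push_cast; rw [zpow_natCast]; ring⟩
  · refine ⟨m, n + j, ?_⟩
    rw [zpow_neg, zpow_natCast, pow_add]
    field_simp

/-- Elements of Thompson's group permute the dyadic points of the interval. -/
theorem IsThompson.dyadic_iff {f : I ≃o I} (hf : IsThompson f) (x : I) :
    IsDyadic (f x : ℝ) ↔ IsDyadic (x : ℝ) := by
  obtain ⟨D, hD, hB⟩ := hf
  have h0 : f 0 = 0 := f.map_bot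
  have key : ∀ N : ℕ, ∀ x : I, (D.filter (· < x)).card ≤ N →
      (IsDyadic (f x : ℝ) ↔ IsDyadic (x : ℝ)) := by
    have step : ∀ a x : I, a < x → (∀ d ∈ D, d ∉ Set.Ioo a x) → IsDyadic (a : ℝ) →
        IsDyadic (f a : ℝ) → (IsDyadic (f x : ℝ) ↔ IsDyadic (x : ℝ)) := by
      intro a x hax hd ha hfa
      obtain ⟨k, hk⟩ := hB a x hax hd
      have hx := hk x ⟨hax.le, le_rfl⟩
      constructor
      · intro h
        have e : (x : ℝ) = a + (2 : ℝ) ^ (-k) * ((f x : ℝ) - f a) := by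
          rw [hx, ← mul_assoc, ← zpow_add₀ (by norm_num)]
          simp
        rw [e]
        exact ha.add ((h.sub hfa).zpow_mul _)
      · intro h
        have e : (f x : ℝ) = f a + (2 : ℝ) ^ k * ((x : ℝ) - a) := by rw [← hx]; ring
        rw [e]
        exact hfa.add ((h.sub ha).zpow_mul _)
    have zero_dyadic : IsDyadic ((0 : I) : ℝ) := ⟨0, 0, by simp⟩
    intro N
    induction N with
    | zero =>
      intro x hx
      rcases eq_or_lt_of_le (unitInterval.nonneg' : (0 : I) ≤ x) with rfl | hpos
      · rw [h0]
      · refine step 0 x hpos ?_ zero_dyadic (by rw [h0]; exact zero_dyadic)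
        intro d hd hdx
        have : d ∈ D.filter (· < x) := Finset.mem_filter.2 ⟨hd, hdx.2⟩
        rw [Nat.le_zero, Finset.card_eq_zero] at hx
        simp [hx] at this
    | succ N ih =>
      intro x hx
      rcases (D.filter (· < x)).eq_empty_or_nonempty with he | hne
      · exact ih x (by simp [he])
      · set m := (D.filter (· < x)).max' hne with hm
        have hmem := Finset.mem_filter.1 ((D.filter (· < x)).max'_mem hne)
        rw [← hm] at hmem
        have hmd : IsDyadic (m : ℝ) := hD m hmem.1
        refine step m x hmem.2 ?_ hmd ((ih m ?_).2 hmd)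
        · intro d hd hdx
          exact absurd ((D.filter (· < x)).le_max' d (Finset.mem_filter.2 ⟨hd, hdx.2⟩))
            (not_le.2 hdx.1)
        · have : (D.filter (· < m)).card < (D.filter (· < x)).card := by
            apply Finset.card_lt_card
            refine ⟨fun d hd => ?_, fun h => ?_⟩
            · have := Finset.mem_filter.1 hd
              exact Finset.mem_filter.2 ⟨this.1, this.2.trans hmem.2⟩
            · exact lt_irrefl _ (Finset.mem_filter.1 (h (Finset.mem_filter.2 hmem))).2
          omega
  exact key _ x le_rfl

/-- Thompson's group `F`, as a group of homeomorphisms of the unit interval. -/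
def thompsonF : Subgroup (I ≃o I) where
  carrier := {f | IsThompson f}
  one_mem' := ⟨∅, by simp, fun a b _ _ => ⟨0, fun y _ => by simp⟩⟩
  mul_mem' := by
    classical
    rintro g f hg hf
    obtain ⟨Dg, hDg, hBg⟩ := id hg
    obtain ⟨Df, hDf, hBf⟩ := id hf
    refine ⟨Df ∪ Dg.image f.symm, ?_, ?_⟩
    · intro d hd
      rcases Finset.mem_union.1 hd with h | h
      · exact hDf d h
      · obtain ⟨e, he, rfl⟩ := Finset.mem_image.1 h
        rw [← hf.dyadic_iff, f.apply_symm_apply]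
        exact hDg e he
    · intro a b hab hd
      obtain ⟨k, hk⟩ := hBf a b hab (fun d h => hd d (Finset.mem_union_left _ h))
      obtain ⟨l, hl⟩ := hBg (f a) (f b) (f.lt_iff_lt.2 hab) (fun d h hdm =>
        hd (f.symm d) (Finset.mem_union_right _ (Finset.mem_image_of_mem _ h))
          ⟨by rw [← f.lt_iff_lt, f.apply_symm_apply]; exact hdm.1,
            by rw [← f.lt_iff_lt, f.apply_symm_apply]; exact hdm.2⟩)
      refine ⟨l + k, fun y hy => ?_⟩
      have h1 := hl (f y) ⟨f.le_iff_le.2 hy.1, f.le_iff_le.2 hy.2⟩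
      have h2 := hk y hy
      change (g (f y) : ℝ) - g (f a) = _
      rw [h1, h2, zpow_add₀ (by norm_num), mul_assoc]
  inv_mem' := by
    classical
    rintro f hf
    obtain ⟨D, hD, hB⟩ := id hf
    refine ⟨D.image f, ?_, ?_⟩
    · intro d hd
      obtain ⟨e, he, rfl⟩ := Finset.mem_image.1 hd
      exact (hf.dyadic_iff e).2 (hD e he)
    · intro a b hab hd
      obtain ⟨k, hk⟩ := hB (f.symm a) (f.symm b) (f.symm.lt_iff_lt.2 hab) (fun d h hdm =>
        hd (f d) (Finset.mem_image_of_mem _ h)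
          ⟨by rw [← f.symm.lt_iff_lt, f.symm_apply_apply]; exact hdm.1,
            by rw [← f.symm.lt_iff_lt, f.symm_apply_apply]; exact hdm.2⟩)
      refine ⟨-k, fun y hy => ?_⟩
      have h1 := hk (f.symm y) ⟨f.symm.le_iff_le.2 hy.1, f.symm.le_iff_le.2 hy.2⟩
      rw [f.apply_symm_apply, f.apply_symm_apply] at h1
      change (f.symm y : ℝ) - f.symm a = _
      rw [h1, ← mul_assoc, ← zpow_add₀ (by norm_num)]
      simp

/-! ### Orientation-preserving homeomorphisms and the mapping class group -/

/-- The path `γ` in the plane, assumed closed, avoids `p` and has winding number `n` around `p`: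
in polar coordinates around `p` it has a continuous angle that increases by `2πn`. -/
def HasWindingNumber (γ : C(I, ℝ × ℝ)) (p : ℝ × ℝ) (n : ℤ) : Prop :=
  ∃ r θ : C(I, ℝ),
    (∀ t, 0 < r t ∧ γ t = p + r t • (Real.cos (θ t), Real.sin (θ t))) ∧
      θ 1 = θ 0 + n * (2 * Real.pi)

/-- The loop in the plane underlying a path in a subspace `S` of the plane. -/
def planePath {S : Set (ℝ × ℝ)} (γ : C(I, S)) : C(I, ℝ × ℝ) :=
  ⟨fun t => (γ t : ℝ × ℝ), by fun_prop⟩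

/-- A homeomorphism `h` of an open subset `S` of the plane preserves the orientation: at every
point `x`, it preserves the winding numbers of small loops around `x`. -/
def IsOrientationPreserving {S : Set (ℝ × ℝ)} (h : S ≃ₜ S) : Prop :=
  ∀ x : S, ∃ V ∈ 𝓝 x, ∀ γ : C(I, S), γ 0 = γ 1 → (∀ t, γ t ∈ V ∧ γ t ≠ x) →
    ∀ n : ℤ, HasWindingNumber (planePath γ) x n ↔
      HasWindingNumber (planePath ((h : C(S, S)).comp γ)) (h x) n

/-- The group of orientation-preserving homeomorphisms of an open subset `S` of the plane. -/
def HomeoPlus (S : Set (ℝ × ℝ)) : Subgroup (S ≃ₜ S) where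
  carrier := {h | IsOrientationPreserving h}
  one_mem' := fun _ => ⟨Set.univ, Filter.univ_mem, fun _ _ _ _ => Iff.rfl⟩
  mul_mem' := by
    rintro g f hg hf x
    obtain ⟨V, hV, hVf⟩ := hf x
    obtain ⟨W, hW, hWg⟩ := hg (f x)
    refine ⟨V ∩ f ⁻¹' W, Filter.inter_mem hV (f.continuous.continuousAt hW), ?_⟩
    intro γ hγ hm n
    refine (hVf γ hγ (fun t => ⟨(hm t).1.1, (hm t).2⟩) n).trans ?_
    exact hWg ((f : C(S, S)).comp γ) (congrArg f hγ)
      (fun t => ⟨(hm t).1.2, fun h => (hm t).2 (f.injective h)⟩) n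
  inv_mem' := by
    rintro f hf x
    obtain ⟨V, hV, hVf⟩ := hf (f.symm x)
    refine ⟨f.symm ⁻¹' V, f.symm.continuous.continuousAt hV, ?_⟩
    intro γ hγ hm n
    have h := hVf ((f.symm : C(S, S)).comp γ) (congrArg f.symm hγ)
      (fun t => ⟨(hm t).1, fun h => (hm t).2 (f.symm.injective h)⟩) n
    have e : (f : C(S, S)).comp ((f.symm : C(S, S)).comp γ) = γ := by
      ext1 t
      exact f.apply_symm_apply (γ t)
    rw [e, f.apply_symm_apply] at h
    exact h.symm

/-- The normal subgroup of the orientation-preserving homeomorphisms that are homotopic to the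
identity. -/
def homotopicToId (S : Set (ℝ × ℝ)) : Subgroup (HomeoPlus S) where
  carrier := {f | ContinuousMap.Homotopic ((f : S ≃ₜ S) : C(S, S)) (ContinuousMap.id S)}
  one_mem' := ContinuousMap.Homotopic.refl _
  mul_mem' := by
    intro f g hf hg
    exact hf.comp hg
  inv_mem' := by
    intro f hf
    have h := (ContinuousMap.Homotopic.refl (((f : S ≃ₜ S).symm : S ≃ₜ S) : C(S, S))).comp hf
    have e : (((f : S ≃ₜ S).symm : S ≃ₜ S) : C(S, S)).comp ((f : S ≃ₜ S) : C(S, S)) =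
        ContinuousMap.id S := by
      ext1 t
      exact (f : S ≃ₜ S).symm_apply_apply t
    rw [e] at h
    exact h.symm

instance homotopicToId_normal (S : Set (ℝ × ℝ)) : (homotopicToId S).Normal where
  conj_mem := by
    intro n hn g
    have h := ((ContinuousMap.Homotopic.refl ((g : S ≃ₜ S) : C(S, S))).comp hn).comp
      (ContinuousMap.Homotopic.refl (((g : S ≃ₜ S).symm : S ≃ₜ S) : C(S, S)))
    have e : (((g : S ≃ₜ S) : C(S, S)).comp (ContinuousMap.id S)).comp
        (((g : S ≃ₜ S).symm : S ≃ₜ S) : C(S, S)) = ContinuousMap.id S := by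
      ext1 t
      exact (g : S ≃ₜ S).apply_symm_apply t
    rw [e] at h
    exact h

/-- The mapping class group of an open subset `S` of the plane: the group of homotopy classes of
orientation-preserving homeomorphisms of `S`. -/
abbrev MappingClassGroup (S : Set (ℝ × ℝ)) : Type := HomeoPlus S ⧸ homotopicToId S

/-- The mapping class of an orientation-preserving homeomorphism. -/
def mappingClass (S : Set (ℝ × ℝ)) : HomeoPlus S →* MappingClassGroup S :=
  QuotientGroup.mk' (homotopicToId S)

/-- Two homeomorphisms represent the same mapping class exactly if they are homotopic. -/
theorem mappingClass_eq_iff {S : Set (ℝ × ℝ)} (f g : HomeoPlus S) :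
    mappingClass S f = mappingClass S g ↔
      ContinuousMap.Homotopic ((f : S ≃ₜ S) : C(S, S)) ((g : S ≃ₜ S) : C(S, S)) := by
  refine QuotientGroup.eq.trans ?_
  change ContinuousMap.Homotopic
    ((((f : S ≃ₜ S).symm : S ≃ₜ S) : C(S, S)).comp ((g : S ≃ₜ S) : C(S, S)))
      (ContinuousMap.id S) ↔ _
  constructor
  · intro h
    have h' := (ContinuousMap.Homotopic.refl ((f : S ≃ₜ S) : C(S, S))).comp h
    have e : ((f : S ≃ₜ S) : C(S, S)).comp
        ((((f : S ≃ₜ S).symm : S ≃ₜ S) : C(S, S)).comp ((g : S ≃ₜ S) : C(S, S))) =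
          ((g : S ≃ₜ S) : C(S, S)) := by
      ext1 t
      exact (f : S ≃ₜ S).apply_symm_apply _
    rw [e] at h'
    exact h'.symm
  · intro h
    have h' := (ContinuousMap.Homotopic.refl
      (((f : S ≃ₜ S).symm : S ≃ₜ S) : C(S, S))).comp h.symm
    have e : (((f : S ≃ₜ S).symm : S ≃ₜ S) : C(S, S)).comp ((f : S ≃ₜ S) : C(S, S)) =
        ContinuousMap.id S := by
      ext1 t
      exact (f : S ≃ₜ S).symm_apply_apply t
    rw [e] at h'
    exact h'

/-! ### Cantor sets in the line, piecewise linear maps, and actions on the plane -/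

/-- `C` is a Cantor set lying in `[0,1] × {0}`. -/
def IsCantorSetInUnitSegment (C : Set (ℝ × ℝ)) : Prop :=
  C ⊆ Set.Icc (0 : ℝ) 1 ×ˢ {(0 : ℝ)} ∧ Nonempty (C ≃ₜ cantorSet)

/-- The middle-thirds Cantor set, placed in `[0,1] × {0}`. -/
def ternaryCantorSet : Set (ℝ × ℝ) := cantorSet ×ˢ {(0 : ℝ)}

/-- A closed convex polyhedron in the plane: a finite intersection of closed half-planes (the
whole plane and the empty set are allowed). -/
def IsPolyhedron (Q : Set (ℝ × ℝ)) : Prop :=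
  ∃ s : Finset (((ℝ × ℝ) →ₗ[ℝ] ℝ) × ℝ), Q = {p | ∀ c ∈ s, c.1 p ≤ c.2}

/-- A homeomorphism of the plane is piecewise linear: the plane is the union of a locally finite
family of closed convex polyhedra on each of which the homeomorphism is affine. -/
def IsPiecewiseLinear (f : (ℝ × ℝ) ≃ₜ (ℝ × ℝ)) : Prop :=
  ∃ P : Set (Set (ℝ × ℝ)), LocallyFinite (fun Q : P => (Q : Set (ℝ × ℝ))) ∧
    ⋃₀ P = Set.univ ∧
    ∀ Q ∈ P, IsPolyhedron Q ∧ ∃ A : (ℝ × ℝ) →ᵃ[ℝ] (ℝ × ℝ), Set.EqOn f A Q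

/-- An action `ρ` of Thompson's group on the plane by homeomorphisms that is carried by the strip
`[0,1] × ℝ` (every element fixes all points outside the strip, hence maps the strip onto itself),
preserves `C` and is faithful on `C`, restricts to an action `τ` on the complement of `C` by
orientation-preserving homeomorphisms, and is such that distinct elements of the group represent
distinct mapping classes. -/
def EmbedsThompson (C : Set (ℝ × ℝ)) (ρ : thompsonF →* ((ℝ × ℝ) ≃ₜ (ℝ × ℝ))) : Prop :=
  (∀ g p, p ∉ Set.Icc (0 : ℝ) 1 ×ˢ (Set.univ : Set ℝ) → ρ g p = p) ∧
  (∀ g, ρ g '' C = C) ∧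
  (∀ g, (∀ p ∈ C, ρ g p = p) → g = 1) ∧
  ∃ τ : thompsonF →* HomeoPlus Cᶜ,
    (∀ g (p : (Cᶜ : Set (ℝ × ℝ))), (((τ g : (Cᶜ : Set (ℝ × ℝ)) ≃ₜ (Cᶜ : Set (ℝ × ℝ))) p :
      (Cᶜ : Set (ℝ × ℝ))) : ℝ × ℝ) = ρ g p) ∧
    Function.Injective ((mappingClass Cᶜ).comp τ)

/-!
Thompson's group acts on a Cantor set in the line because the gaps of the Cantor set are ordered like
the dyadic rationals in the open unit interval, which Thompson's group permutes preserving the order.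
Everything else is extracted from this action.

**The action.** A *staircase* over a Cantor set `K` (`IsStaircase`) is a monotone map `ψ` of the line
onto itself that collapses exactly the gaps of `K`, the values on the gaps being the dyadic rationals
in `(0,1)`; the Cantor function is the prototype. An element of Thompson's group, extended by the
identity to the line, preserves the set of points with nondegenerate fibres, so it lifts along `ψ` to
a homeomorphism of the line that maps fibres affinely onto fibres (`liftFun`). Lifting is compatible
with composition (`liftFun_liftFun`) and preserves `K`; the action on `K` is faithful because `ψ` maps
`K` onto the unit interval. The action on the plane is the lift times the identity. Staircases exist
over every Cantor set by Cantor's theorem on countable dense orders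
(`IsCantorInLine.exists_isStaircase`). For the middle-thirds Cantor set the Cantor function is one
(`isStaircase_ternaryStair`), and its self-similarity shows that the lift is affine on each of
finitely many intervals: an element of Thompson's group maps each interval of a fine dyadic
subdivision affinely onto a standard dyadic interval (`IsThompson.exists_subdivision`), and the lift
maps the corresponding triadic intervals affinely onto each other (`lineAction_triadic`).

**Mapping classes.** Winding numbers are invariant under homotopies of loops around a moving base
point (`hasWindingNumber_iff_of_homotopy`). A homeomorphism that moves points horizontally by an
increasing map is isotopic to the identity in the plane by convex combinations, hence it preserves
the orientation. If it moves a point `q` of `K` to the right, some circle around `q` avoiding `K` is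
mapped to the right of `q`, so that its winding number around `q` drops from one to zero, and the
homeomorphism is not homotopic to the identity in the complement of `K` (`not_homotopic_id_of_fst`).
Therefore Thompson's group embeds into the mapping class group.

**The Tits alternative.** Thompson's group has elements with arbitrarily small support, and powers
of them lie in any subgroup of finite index; taking commutators with elements of small support yields
nontrivial elements in all terms of its derived series (`exists_mem_derivedSeries_supported`). The
absence of free subgroups is the argument of Brin and Squier. A commutator of elements of the
subgroup is trivial near the ends of the components of the complement of the global fixed points. A
suitable conjugate has, within one component, support disjoint from the original one, so the
commutator of the two lives on fewer components, and by induction it is trivial. But commuting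
elements of a free group have a common power (`freeGroup_exists_zpow_eq_zpow_of_commute`), which
disjointness of the supports excludes.
-/

/-! ### Commuting elements of free groups -/

/-- Two commuting elements of a free group satisfy a nontrivial relation `w ^ m = v ^ n`: by the
Nielsen–Schreier theorem they generate a free group, which is abelian and hence cyclic. -/
theorem freeGroup_exists_zpow_eq_zpow_of_commute {α : Type} {w v : FreeGroup α}
    (h : Commute w v) : ∃ m n : ℤ, (m ≠ 0 ∨ n ≠ 0) ∧ w ^ m = v ^ n := by
  classical
  set H : Subgroup (FreeGroup α) := Subgroup.closure {w, v} with hH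
  have hw : w ∈ H := Subgroup.subset_closure (by simp)
  have hv : v ∈ H := Subgroup.subset_closure (by simp)
  have hcomm : ∀ x y : H, x * y = y * x := by
    have := Subgroup.isMulCommutative_closure (k := {w, v}) (by
      intro x hx y hy
      simp only [Set.mem_insert_iff, Set.mem_singleton_iff] at hx hy
      rcases hx with rfl | rfl <;> rcases hy with rfl | rfl
      · exact rfl
      · exact h
      · exact h.symm
      · exact rfl)
    exact fun x y => this.is_comm.comm x y
  let e := IsFreeGroup.toFreeGroup H
  have hcomm' : ∀ x y : FreeGroup (IsFreeGroup.Generators H), x * y = y * x := by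
    intro x y
    apply e.symm.injective
    rw [map_mul, map_mul, hcomm]
  have hsub : Subsingleton (IsFreeGroup.Generators H) := by
    refine ⟨fun a b => ?_⟩
    have := congrArg FreeGroup.toWord (hcomm' (FreeGroup.of a) (FreeGroup.of b))
    by_contra hab
    simp [FreeGroup.toWord_mul, FreeGroup.toWord_of, FreeGroup.reduce, hab] at this
  obtain ⟨z, hz⟩ : ∃ z : FreeGroup (IsFreeGroup.Generators H), ∀ x, ∃ k : ℤ, x = z ^ k := by
    rcases isEmpty_or_nonempty (IsFreeGroup.Generators H) with hE | ⟨⟨a⟩⟩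
    · exact ⟨1, fun x => ⟨0, Subsingleton.elim _ _⟩⟩
    · refine ⟨FreeGroup.of a, fun x => ?_⟩
      induction x using FreeGroup.induction_on with
      | C1 => exact ⟨0, by simp⟩
      | of b => exact ⟨1, by rw [Subsingleton.elim b a, zpow_one]⟩
      | inv_of b _ => exact ⟨-1, by rw [Subsingleton.elim b a, zpow_neg_one]⟩
      | mul x y hx hy =>
        obtain ⟨k, hk⟩ := hx
        obtain ⟨l, hl⟩ := hy
        exact ⟨k + l, by rw [zpow_add, ← hk, ← hl]⟩
  obtain ⟨p, hp⟩ := hz (e ⟨w, hw⟩)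
  obtain ⟨q, hq⟩ := hz (e ⟨v, hv⟩)
  have key : ∀ m n : ℤ, p * m = q * n → w ^ m = v ^ n := by
    intro m n hmn
    have : e (⟨w, hw⟩ ^ m) = e (⟨v, hv⟩ ^ n) := by
      rw [map_zpow, map_zpow, hp, hq, ← zpow_mul, ← zpow_mul, hmn]
    simpa using congrArg Subtype.val (e.injective this)
  by_cases h0 : p = 0 ∧ q = 0
  · exact ⟨1, 1, Or.inl one_ne_zero, key 1 1 (by rw [h0.1, h0.2])⟩
  · refine ⟨q, p, ?_, key q p (mul_comm _ _)⟩
    by_contra h'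
    push Not at h'
    exact h0 ⟨h'.2, h'.1⟩

/-! ### Invariance of the group-theoretic notions -/

theorem VirtuallySolvable.of_mulEquiv {G H : Type*} [Group G] [Group H] (e : G ≃* H)
    (h : VirtuallySolvable H) : VirtuallySolvable G := by
  obtain ⟨N, hN, hf⟩ := h
  refine ⟨N.comap e.toMonoidHom, ?_, ⟨?_⟩⟩
  swap
  · rw [Subgroup.index_comap_of_surjective _ e.surjective]
    exact hf.index_ne_zero
  refine Group.isSolvable_of_isSolvable_injective (f := (e.toMonoidHom.subgroupComap N)) ?_
  intro x y hxy
  have := congrArg Subtype.val hxy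
  exact Subtype.ext (e.injective this)

theorem ContainsNonabelianFree.of_mulEquiv {G H : Type*} [Group G] [Group H] (e : G ≃* H)
    (h : ContainsNonabelianFree H) : ContainsNonabelianFree G := by
  obtain ⟨φ, hφ⟩ := h
  exact ⟨e.symm.toMonoidHom.comp φ, e.symm.injective.comp hφ⟩

/-- A group into which `G` embeds violates the classical Tits alternative as soon as `G` is neither
virtually solvable nor contains a nonabelian free group. -/
theorem not_classicalTitsAlternative_of_injective {G H : Type*} [Group G] [Group H] (f : G →* H)
    (hf : Function.Injective f) (h1 : ¬ VirtuallySolvable G) (h2 : ¬ ContainsNonabelianFree G) :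
    ¬ ClassicalTitsAlternative H := by
  intro h
  have e := MonoidHom.ofInjective hf
  rcases h f.range with h | h
  · exact h1 (h.of_mulEquiv e)
  · exact h2 (h.of_mulEquiv e)

section Groups

open scoped commutatorElement

/-! ### Thompson's group is not virtually solvable -/

theorem OrderIso.pow_apply_ne {α : Type*} [LinearOrder α] (f : α ≃o α) {x : α} (h : f x ≠ x)
    {n : ℕ} (hn : n ≠ 0) : (f ^ n) x ≠ x := by
  obtain ⟨n, rfl⟩ := Nat.exists_eq_succ_of_ne_zero hn
  rcases lt_or_gt_of_ne h with h | h
  · have : ∀ n : ℕ, (f ^ (n + 1)) x < x := by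
      intro n
      induction n with
      | zero => simpa using h
      | succ n ih =>
        rw [pow_succ]
        exact ((f ^ (n + 1)).lt_iff_lt.2 h).trans ih
    exact (this n).ne
  · have : ∀ n : ℕ, x < (f ^ (n + 1)) x := by
      intro n
      induction n with
      | zero => simpa using h
      | succ n ih =>
        rw [pow_succ]
        exact ih.trans ((f ^ (n + 1)).lt_iff_lt.2 h)
    exact (this n).ne'

theorem OrderIso.zpow_apply_ne {α : Type*} [LinearOrder α] (f : α ≃o α) {x : α} (h : f x ≠ x)
    {m : ℤ} (hm : m ≠ 0) : (f ^ m) x ≠ x := by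
  obtain ⟨n, rfl | rfl⟩ := m.eq_nat_or_neg
  · rw [zpow_natCast]
    exact f.pow_apply_ne h (by simpa using hm)
  · rw [zpow_neg, zpow_natCast]
    intro h'
    have h2 := congrArg (f ^ n) h'
    change (f ^ n) ((f ^ n).symm x) = _ at h2
    rw [OrderIso.apply_symm_apply] at h2
    exact f.pow_apply_ne h (by simpa using hm) h2.symm

/-- The basic bump: slopes `2`, `1`, `1/2` on the successive intervals of lengths `δ`, `δ`, `2δ`
starting at `a`, and the identity elsewhere. -/
noncomputable def bumpFun (a δ x : ℝ) : ℝ := x + max 0 (min (min (x - a) δ) ((a + 4 * δ - x) / 2))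

/-- The inverse of the basic bump. -/
noncomputable def bumpInv (a δ y : ℝ) : ℝ := y - max 0 (min (min ((y - a) / 2) δ) (a + 4 * δ - y))

theorem bumpFun_bumpInv {a δ : ℝ} (hδ : 0 < δ) (y : ℝ) : bumpFun a δ (bumpInv a δ y) = y := by
  unfold bumpFun bumpInv
  grind

theorem bumpFun_strictMono {a δ : ℝ} (hδ : 0 < δ) : StrictMono (bumpFun a δ) := by
  intro x y h
  unfold bumpFun
  grind

theorem bumpFun_of_notMem {a δ x : ℝ} (hx : x ∉ Set.Ioo a (a + 4 * δ)) : bumpFun a δ x = x := by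
  unfold bumpFun
  rw [Set.mem_Ioo, not_and_or, not_lt, not_lt] at hx
  grind

/-- The basic bump as an order isomorphism of the unit interval. -/
noncomputable def bump (a δ : ℝ) (ha : 0 ≤ a) (hδ : 0 < δ) (h1 : a + 4 * δ ≤ 1) : I ≃o I :=
  StrictMono.orderIsoOfRightInverse
    (fun x => ⟨bumpFun a δ x, by
      have h0 : bumpFun a δ 0 = 0 := bumpFun_of_notMem (fun h => absurd h.1 (not_lt.2 ha))
      have h1 : bumpFun a δ 1 = 1 := bumpFun_of_notMem (fun h => absurd h.2 (not_lt.2 h1))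
      constructor
      · exact h0.symm.le.trans ((bumpFun_strictMono hδ).monotone x.2.1)
      · exact ((bumpFun_strictMono hδ).monotone x.2.2).trans h1.le⟩)
    (fun _ _ h => bumpFun_strictMono hδ h)
    (fun x => ⟨bumpInv a δ x, by
      have h0 : bumpFun a δ 0 = 0 := bumpFun_of_notMem (fun h => absurd h.1 (not_lt.2 ha))
      have h1 : bumpFun a δ 1 = 1 := bumpFun_of_notMem (fun h => absurd h.2 (not_lt.2 h1))
      constructor
      · rw [← (bumpFun_strictMono hδ).le_iff_le, bumpFun_bumpInv hδ, h0]
        exact x.2.1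
      · rw [← (bumpFun_strictMono hδ).le_iff_le, bumpFun_bumpInv hδ, h1]
        exact x.2.2⟩)
    (fun x => Subtype.ext (bumpFun_bumpInv hδ x))

theorem bump_apply (a δ : ℝ) (ha : 0 ≤ a) (hδ : 0 < δ) (h1 : a + 4 * δ ≤ 1) (x : I) :
    (bump a δ ha hδ h1 x : ℝ) = bumpFun a δ x := rfl

/-- The bump is affine, with slope a power of two, between consecutive breakpoints. -/
theorem exists_bumpFun_slope {a δ p q : ℝ} (hδ : 0 < δ) (hpq : p < q) (c0 : ¬ (p < a ∧ a < q))
    (c1 : ¬ (p < a + δ ∧ a + δ < q)) (c2 : ¬ (p < a + 2 * δ ∧ a + 2 * δ < q))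
    (c4 : ¬ (p < a + 4 * δ ∧ a + 4 * δ < q)) :
    ∃ k : ℤ, ∀ y, p ≤ y → y ≤ q → bumpFun a δ y - bumpFun a δ p = (2 : ℝ) ^ k * (y - p) := by
  have cases : q ≤ a ∨ (a ≤ p ∧ q ≤ a + δ) ∨ (a + δ ≤ p ∧ q ≤ a + 2 * δ) ∨
      (a + 2 * δ ≤ p ∧ q ≤ a + 4 * δ) ∨ a + 4 * δ ≤ p := by grind
  clear c0 c1 c2 c4
  unfold bumpFun
  rcases cases with c | c | c | c | c
  · refine ⟨0, fun y hy1 hy2 => ?_⟩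
    rw [zpow_zero]
    grind
  · refine ⟨1, fun y hy1 hy2 => ?_⟩
    rw [zpow_one]
    grind
  · refine ⟨0, fun y hy1 hy2 => ?_⟩
    rw [zpow_zero]
    grind
  · refine ⟨-1, fun y hy1 hy2 => ?_⟩
    rw [zpow_neg_one]
    grind
  · refine ⟨0, fun y hy1 hy2 => ?_⟩
    rw [zpow_zero]
    grind

theorem isThompson_bump {a δ : ℝ} (ha : 0 ≤ a) (hδ : 0 < δ) (h1 : a + 4 * δ ≤ 1)
    (hda : IsDyadic a) (hdδ : IsDyadic δ) : IsThompson (bump a δ ha hδ h1) := by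
  classical
  have two : IsDyadic (2 * δ) := by rw [two_mul]; exact hdδ.add hdδ
  have four : IsDyadic (4 * δ) := by
    rw [show 4 * δ = 2 * δ + 2 * δ by ring]; exact two.add two
  let d0 : I := ⟨a, ha, by linarith⟩
  let d1 : I := ⟨a + δ, by linarith, by linarith⟩
  let d2 : I := ⟨a + 2 * δ, by linarith, by linarith⟩
  let d4 : I := ⟨a + 4 * δ, by linarith, h1⟩
  refine ⟨{d0, d1, d2, d4}, ?_, ?_⟩
  · intro d hd
    simp only [Finset.mem_insert, Finset.mem_singleton] at hd
    rcases hd with rfl | rfl | rfl | rfl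
    · exact hda
    · exact hda.add hdδ
    · exact hda.add two
    · exact hda.add four
  · intro p q hpq hD
    have c0 : ¬ ((p : ℝ) < a ∧ a < q) := hD d0 (by simp)
    have c1 : ¬ ((p : ℝ) < a + δ ∧ a + δ < q) := hD d1 (by simp)
    have c2 : ¬ ((p : ℝ) < a + 2 * δ ∧ a + 2 * δ < q) := hD d2 (by simp)
    have c4 : ¬ ((p : ℝ) < a + 4 * δ ∧ a + 4 * δ < q) := hD d4 (by simp)
    have hpq' : (p : ℝ) < q := hpq
    simp only [bump_apply]
    obtain ⟨k, hk⟩ := exists_bumpFun_slope hδ hpq' c0 c1 c2 c4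
    exact ⟨k, fun y hy => hk y hy.1 hy.2⟩

/-- Thompson's group has nontrivial elements supported in any given interval. -/
theorem exists_isThompson_supported {p q : I} (hpq : p < q) :
    ∃ f : I ≃o I, IsThompson f ∧ f ≠ 1 ∧ ∀ x ∉ Set.Ioo p q, f x = x := by
  have hpq' : (p : ℝ) < q := hpq
  obtain ⟨n, hn⟩ := exists_pow_lt_of_lt_one (show 0 < ((q : ℝ) - p) / 5 by linarith)
    (show (1 / 2 : ℝ) < 1 by norm_num)
  rw [one_div, inv_pow] at hn
  set δ : ℝ := (2 ^ n)⁻¹ with hδ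
  have hδ0 : 0 < δ := by positivity
  have e : δ * 2 ^ n = 1 := by rw [hδ]; field_simp
  set k : ℤ := ⌊(p : ℝ) * 2 ^ n⌋ + 1 with hk
  have hk1 : (p : ℝ) * 2 ^ n < k := by rw [hk]; push_cast; exact Int.lt_floor_add_one _
  have hk2 : (k : ℝ) ≤ p * 2 ^ n + 1 := by
    rw [hk]; push_cast; linarith [Int.floor_le ((p : ℝ) * 2 ^ n)]
  have ha1 : (p : ℝ) < k * δ := by
    have := mul_lt_mul_of_pos_right hk1 hδ0
    rwa [mul_assoc, mul_comm (2 ^ n) δ, e, mul_one] at this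
  have ha2 : k * δ ≤ p + δ := by
    have := mul_le_mul_of_nonneg_right hk2 hδ0.le
    rwa [add_mul, mul_assoc, mul_comm (2 ^ n) δ, e, mul_one, one_mul] at this
  have hp0 := p.2.1
  have hq1 := q.2.2
  have ha0 : 0 ≤ k * δ := by linarith
  have h4 : k * δ + 4 * δ ≤ 1 := by linarith
  refine ⟨bump (k * δ) δ ha0 hδ0 h4, isThompson_bump _ _ _ ⟨k, n, by rw [hδ]; rfl⟩
    ⟨1, n, by rw [hδ]; simp⟩, ?_, ?_⟩
  · intro h
    have h' := congrArg (fun f : I ≃o I => (f ⟨k * δ + δ, by linarith, by linarith⟩ : ℝ)) h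
    simp only [bump_apply, bumpFun, RelIso.one_apply] at h'
    grind
  · intro x hx
    apply Subtype.ext
    rw [bump_apply]
    apply bumpFun_of_notMem
    intro h
    exact hx ⟨show (p : ℝ) < x from ha1.trans h.1, show (x : ℝ) < q by linarith [h.2]⟩

/-- If a group acting on the interval has nontrivial elements with arbitrarily small support, then
so does every term of its derived series: an element displacing a small interval off itself does
not commute with any nontrivial element supported in that interval. -/
theorem exists_mem_derivedSeries_supported {G : Type*} [Group G] (act : G →* (I ≃o I))
    (h : ∀ p q : I, p < q → ∃ w : G, act w ≠ 1 ∧ ∀ x ∉ Set.Ioo p q, act w x = x) (n : ℕ) :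
    ∀ p q : I, p < q →
      ∃ w ∈ derivedSeries G n, act w ≠ 1 ∧ ∀ x ∉ Set.Ioo p q, act w x = x := by
  have symm_fix : ∀ (w : G) (x : I), act w x = x → (act w).symm x = x := fun w x hx => by
    rw [OrderIso.symm_apply_eq, hx]
  induction n with
  | zero =>
    intro p q hpq
    obtain ⟨w, hw⟩ := h p q hpq
    exact ⟨w, by simp, hw⟩
  | succ n ih =>
    intro p q hpq
    obtain ⟨w, hwD, hw1, hws⟩ := ih p q hpq
    obtain ⟨x, hx⟩ : ∃ x, act w x ≠ x := by
      by_contra! hc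
      exact hw1 (OrderIso.ext (funext hc))
    have hxJ : x ∈ Set.Ioo p q := by
      by_contra hc
      exact hx (hws x hc)
    have hwp : act w p = p := hws p (by simp)
    have hwq : act w q = q := hws q (by simp)
    have hwxp : p < act w x := by rw [← hwp]; exact (act w).lt_iff_lt.2 hxJ.1
    have hwxq : act w x < q := by rw [← hwq]; exact (act w).lt_iff_lt.2 hxJ.2
    obtain ⟨p', q', hp', hpq', hq', hdisj⟩ : ∃ p' q', p ≤ p' ∧ p' < q' ∧ q' ≤ q ∧
        ∀ y ∈ Set.Ioo p' q', act w y ∉ Set.Ioo p' q' := by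
      rcases lt_or_gt_of_ne hx with hlt | hgt
      · exact ⟨act w x, x, hwxp.le, hlt, hxJ.2.le,
          fun y hy h' => absurd h'.1 (not_lt.2 ((act w).le_iff_le.2 hy.2.le))⟩
      · exact ⟨x, act w x, hxJ.1.le, hgt, hwxq.le,
          fun y hy h' => absurd h'.2 (not_lt.2 ((act w).le_iff_le.2 hy.1.le))⟩
    obtain ⟨v, hvD, hv1, hvs⟩ := ih p' q' hpq'
    obtain ⟨y, hy⟩ : ∃ y, act v y ≠ y := by
      by_contra! hc
      exact hv1 (OrderIso.ext (funext hc))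
    have hyJ : y ∈ Set.Ioo p' q' := by
      by_contra hc
      exact hy (hvs y hc)
    have act_comm : ∀ z, act ⁅w, v⁆ z = act w (act v ((act w).symm ((act v).symm z))) := by
      intro z
      rw [commutatorElement_def, map_mul, map_mul, map_mul, map_inv, map_inv]
      rfl
    refine ⟨⁅w, v⁆, Subgroup.commutator_mem_commutator hwD hvD, ?_, ?_⟩
    · intro hc
      have e := act_comm (act v y)
      rw [hc, OrderIso.symm_apply_apply, hvs ((act w).symm y) ?_, OrderIso.apply_symm_apply] at e
      · exact hy e
      · intro h'
        have := hdisj _ h'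
        rw [OrderIso.apply_symm_apply] at this
        exact this hyJ
    · intro z hz
      have hz' : z ∉ Set.Ioo p' q' := fun h' => hz ⟨hp'.trans_lt h'.1, h'.2.trans_le hq'⟩
      rw [act_comm, symm_fix v z (hvs z hz'), symm_fix w z (hws z hz), hvs z hz', hws z hz]

theorem not_virtuallySolvable_thompsonF : ¬ VirtuallySolvable thompsonF := by
  rintro ⟨N, ⟨n, hn⟩, hfin⟩
  let act : N →* (I ≃o I) := thompsonF.subtype.comp N.subtype
  have hsupp : ∀ p q : I, p < q → ∃ w : N, act w ≠ 1 ∧ ∀ x ∉ Set.Ioo p q, act w x = x := by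
    intro p q hpq
    obtain ⟨f, hf, hf1, hfs⟩ := exists_isThompson_supported hpq
    obtain ⟨m, hm0, -, hm⟩ :=
      Subgroup.exists_pow_mem_of_index_ne_zero hfin.index_ne_zero (⟨f, hf⟩ : thompsonF)
    have hact : act ⟨_, hm⟩ = f ^ m := rfl
    refine ⟨⟨_, hm⟩, ?_, ?_⟩
    · obtain ⟨x, hx⟩ : ∃ x, f x ≠ x := by
        by_contra! hc
        exact hf1 (OrderIso.ext (funext hc))
      intro hc
      rw [hact] at hc
      exact f.pow_apply_ne hx hm0.ne' (by rw [hc]; rfl)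
    · intro x hx
      rw [hact]
      clear hact hm hm0
      induction m with
      | zero => rfl
      | succ m ih =>
        rw [pow_succ]
        change (f ^ m) (f x) = x
        rw [hfs x hx, ih]
  obtain ⟨w, hw, hw1, -⟩ := exists_mem_derivedSeries_supported act hsupp n 0 1 zero_lt_one
  rw [hn, Subgroup.mem_bot] at hw
  exact hw1 (by rw [hw, map_one])

/-! ### Thompson's group contains no nonabelian free group -/

/-- `(a, b)` is a component of the complement of `E`. -/
structure IsComplComponent (E : Set I) (a b : I) : Prop where
  left_mem : a ∈ E
  right_mem : b ∈ E
  lt : a < b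
  notMem : ∀ x ∈ Set.Ioo a b, x ∉ E

theorem exists_isComplComponent {E : Set I} (hE : IsClosed E) (h0 : (0 : I) ∈ E) (h1 : (1 : I) ∈ E)
    {x : I} (hx : x ∉ E) : ∃ a b, IsComplComponent E a b ∧ x ∈ Set.Ioo a b := by
  obtain ⟨a, ⟨haE, hax⟩, ha⟩ := (hE.inter isClosed_Iic).isCompact.exists_isGreatest
    (⟨0, h0, unitInterval.nonneg'⟩ : (E ∩ Set.Iic x).Nonempty)
  obtain ⟨b, ⟨hbE, hbx⟩, hb⟩ := (hE.inter isClosed_Ici).isCompact.exists_isLeast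
    (⟨1, h1, unitInterval.le_one'⟩ : (E ∩ Set.Ici x).Nonempty)
  have hax' : a < x := lt_of_le_of_ne hax (fun h => hx (h ▸ haE))
  have hbx' : x < b := lt_of_le_of_ne hbx (fun h => hx (h ▸ hbE))
  refine ⟨a, b, ⟨haE, hbE, hax'.trans hbx', fun y hy hyE => ?_⟩, hax', hbx'⟩
  rcases le_total y x with h | h
  · exact absurd (ha ⟨hyE, h⟩) (not_le.2 hy.1)
  · exact absurd (hb ⟨hyE, h⟩) (not_le.2 hy.2)

theorem IsComplComponent.eq_of_mem {E : Set I} {a b a' b' x : I} (h : IsComplComponent E a b)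
    (h' : IsComplComponent E a' b') (hx : x ∈ Set.Ioo a b) (hx' : x ∈ Set.Ioo a' b') :
    a = a' ∧ b = b' := by
  constructor
  · rcases lt_trichotomy a a' with hlt | heq | hgt
    · exact absurd h'.left_mem (h.notMem a' ⟨hlt, hx'.1.trans hx.2⟩)
    · exact heq
    · exact absurd h.left_mem (h'.notMem a ⟨hgt, hx.1.trans hx'.2⟩)
  · rcases lt_trichotomy b b' with hlt | heq | hgt
    · exact absurd h.right_mem (h'.notMem b ⟨hx'.1.trans hx.2, hlt⟩)
    · exact heq
    · exact absurd h'.right_mem (h.notMem b' ⟨hx.1.trans hx'.2, hgt⟩)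

theorem IsThompson.exists_slope_right {f : I ≃o I} (hf : IsThompson f) {a b : I} (hab : a < b) :
    ∃ e, a < e ∧ e ≤ b ∧ ∃ k : ℤ, ∀ y ∈ Set.Icc a e, (f y : ℝ) - f a = (2 : ℝ) ^ k * (y - a) := by
  classical
  obtain ⟨D, -, hD⟩ := hf
  set s : Finset I := insert b (D.filter (a < ·)) with hs
  have hsne : s.Nonempty := ⟨b, Finset.mem_insert_self _ _⟩
  have hlt : a < s.min' hsne := by
    rw [Finset.lt_min'_iff]
    intro y hy
    rcases Finset.mem_insert.1 hy with rfl | hy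
    · exact hab
    · exact (Finset.mem_filter.1 hy).2
  refine ⟨s.min' hsne, hlt, s.min'_le _ (Finset.mem_insert_self _ _), hD a _ hlt ?_⟩
  intro d hd hd'
  exact absurd (s.min'_le d (Finset.mem_insert_of_mem (Finset.mem_filter.2 ⟨hd, hd'.1⟩)))
    (not_le.2 hd'.2)

theorem IsThompson.exists_slope_left {f : I ≃o I} (hf : IsThompson f) {a b : I} (hab : a < b) :
    ∃ e, a ≤ e ∧ e < b ∧ ∃ k : ℤ, ∀ y ∈ Set.Icc e b, (f b : ℝ) - f y = (2 : ℝ) ^ k * (b - y) := by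
  classical
  obtain ⟨D, -, hD⟩ := hf
  set s : Finset I := insert a (D.filter (· < b)) with hs
  have hsne : s.Nonempty := ⟨a, Finset.mem_insert_self _ _⟩
  have hlt : s.max' hsne < b := by
    rw [Finset.max'_lt_iff]
    intro y hy
    rcases Finset.mem_insert.1 hy with rfl | hy
    · exact hab
    · exact (Finset.mem_filter.1 hy).2
  obtain ⟨k, hk⟩ := hD (s.max' hsne) b hlt (by
    intro d hd hd'
    exact absurd (s.le_max' d (Finset.mem_insert_of_mem (Finset.mem_filter.2 ⟨hd, hd'.2⟩)))
      (not_le.2 hd'.1))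
  refine ⟨s.max' hsne, s.le_max' _ (Finset.mem_insert_self _ _), hlt, k, fun y hy => ?_⟩
  have h1 := hk y hy
  have h2 := hk b ⟨hlt.le, le_rfl⟩
  linear_combination h2 - h1

/-- Elements of Thompson's group fixing `a` commute to the right of `a`, being linear there. -/
theorem IsThompson.exists_commute_right {f g : I ≃o I} (hf : IsThompson f) (hg : IsThompson g)
    {a b : I} (hab : a < b) (hfa : f a = a) (hga : g a = a) :
    ∃ e, a < e ∧ ∀ y ∈ Set.Icc a e, f (g y) = g (f y) := by
  obtain ⟨e, hae, -, k, hk⟩ := hf.exists_slope_right hab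
  obtain ⟨e', hae', -, l, hl⟩ := hg.exists_slope_right hab
  rw [hfa] at hk
  rw [hga] at hl
  have hge : a < g.symm e := by rw [← g.lt_iff_lt, hga, g.apply_symm_apply]; exact hae
  have hfe : a < f.symm e' := by rw [← f.lt_iff_lt, hfa, f.apply_symm_apply]; exact hae'
  refine ⟨min (min e e') (min (g.symm e) (f.symm e')),
    lt_min (lt_min hae hae') (lt_min hge hfe), fun y hy => ?_⟩
  have h1 : y ≤ e := hy.2.trans ((min_le_left _ _).trans (min_le_left _ _))
  have h2 : y ≤ e' := hy.2.trans ((min_le_left _ _).trans (min_le_right _ _))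
  have h3 : g y ≤ e := g.le_symm_apply.1 (hy.2.trans ((min_le_right _ _).trans (min_le_left _ _)))
  have h4 : f y ≤ e' := f.le_symm_apply.1 (hy.2.trans ((min_le_right _ _).trans (min_le_right _ _)))
  have h5 : a ≤ g y := by rw [← hga]; exact g.le_iff_le.2 hy.1
  have h6 : a ≤ f y := by rw [← hfa]; exact f.le_iff_le.2 hy.1
  apply Subtype.ext
  have e1 := hk (g y) ⟨h5, h3⟩
  have e2 := hl (f y) ⟨h6, h4⟩
  rw [hl y ⟨hy.1, h2⟩] at e1
  rw [hk y ⟨hy.1, h1⟩] at e2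
  linear_combination e1 - e2

/-- Elements of Thompson's group fixing `b` commute to the left of `b`, being linear there. -/
theorem IsThompson.exists_commute_left {f g : I ≃o I} (hf : IsThompson f) (hg : IsThompson g)
    {a b : I} (hab : a < b) (hfb : f b = b) (hgb : g b = b) :
    ∃ e, e < b ∧ ∀ y ∈ Set.Icc e b, f (g y) = g (f y) := by
  obtain ⟨e, -, hae, k, hk⟩ := hf.exists_slope_left hab
  obtain ⟨e', -, hae', l, hl⟩ := hg.exists_slope_left hab
  rw [hfb] at hk
  rw [hgb] at hl
  have hge : g.symm e < b := by rw [← g.lt_iff_lt, hgb, g.apply_symm_apply]; exact hae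
  have hfe : f.symm e' < b := by rw [← f.lt_iff_lt, hfb, f.apply_symm_apply]; exact hae'
  refine ⟨max (max e e') (max (g.symm e) (f.symm e')),
    max_lt (max_lt hae hae') (max_lt hge hfe), fun y hy => ?_⟩
  have h1 : e ≤ y := ((le_max_left _ _).trans (le_max_left _ _)).trans hy.1
  have h2 : e' ≤ y := ((le_max_right _ _).trans (le_max_left _ _)).trans hy.1
  have h3 : e ≤ g y := g.symm_apply_le.1 (((le_max_left _ _).trans (le_max_right _ _)).trans hy.1)
  have h4 : e' ≤ f y := f.symm_apply_le.1 (((le_max_right _ _).trans (le_max_right _ _)).trans hy.1)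
  have h5 : g y ≤ b := by rw [← hgb]; exact g.le_iff_le.2 hy.2
  have h6 : f y ≤ b := by rw [← hfb]; exact f.le_iff_le.2 hy.2
  apply Subtype.ext
  have e1 := hk (g y) ⟨h3, h5⟩
  have e2 := hl (f y) ⟨h4, h6⟩
  rw [hl y ⟨h2, hy.2⟩] at e1
  rw [hk y ⟨h1, hy.2⟩] at e2
  linear_combination e2 - e1

theorem map_commutatorElement_apply {G : Type*} [Group G] (act : G →* (I ≃o I)) (u v : G) (z : I) :
    act ⁅u, v⁆ z = act u (act v ((act u).symm ((act v).symm z))) := by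
  rw [commutatorElement_def, map_mul, map_mul, map_mul, map_inv, map_inv]
  rfl

theorem map_mul_inv_apply {G : Type*} [Group G] (act : G →* (I ≃o I)) (h w : G) (z : I) :
    act (h * w * h⁻¹) z = act h (act w ((act h).symm z)) := by
  rw [map_mul, map_mul, map_inv]
  rfl

/-- A commutator of elements of Thompson's group is trivial near the ends of an interval that is
invariant under both of them. -/
theorem exists_commutatorElement_fix {G : Type*} [Group G] (act : G →* (I ≃o I))
    (hT : ∀ w, IsThompson (act w)) {a b : I} (hab : a < b) (ha : ∀ w, act w a = a)
    (hb : ∀ w, act w b = b) (u v : G) :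
    ∃ c d, a < c ∧ d < b ∧ ∀ z ∈ Set.Icc a b, (z ≤ c ∨ d ≤ z) → act ⁅u, v⁆ z = z := by
  obtain ⟨e, hae, he⟩ := (hT u).exists_commute_right (hT v) hab (ha u) (ha v)
  obtain ⟨e', heb, he'⟩ := (hT u).exists_commute_left (hT v) hab (hb u) (hb v)
  have key : ∀ z, act u (act v ((act u).symm ((act v).symm z))) =
      act v (act u ((act u).symm ((act v).symm z))) → act ⁅u, v⁆ z = z := by
    intro z hz
    rw [map_commutatorElement_apply, hz]
    simp
  have symm_a : ∀ w, (act w).symm a = a := fun w => by rw [OrderIso.symm_apply_eq, ha]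
  have symm_b : ∀ w, (act w).symm b = b := fun w => by rw [OrderIso.symm_apply_eq, hb]
  refine ⟨act v (act u e), act v (act u e'), ?_, ?_, fun z hz h => key z ?_⟩
  · have := (act v).lt_iff_lt.2 ((act u).lt_iff_lt.2 hae)
    rwa [ha, ha] at this
  · have := (act v).lt_iff_lt.2 ((act u).lt_iff_lt.2 heb)
    rwa [hb, hb] at this
  · rcases h with h | h
    · apply he
      constructor
      · rw [(act u).le_symm_apply, (act v).le_symm_apply, ha, ha]
        exact hz.1
      · rw [(act u).symm_apply_le, (act v).symm_apply_le]
        exact h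
    · apply he'
      constructor
      · rw [(act u).le_symm_apply, (act v).le_symm_apply]
        exact h
      · rw [(act u).symm_apply_le, (act v).symm_apply_le, hb, hb]
        exact hz.2

/-- A point in an interval without global fixed points can be moved arbitrarily close to the right
end, since the supremum of its orbit is a global fixed point. -/
theorem exists_lt_apply_of_no_fixed {G : Type*} [Group G] (act : G →* (I ≃o I)) {a b c d : I}
    (hno : ∀ x ∈ Set.Ioo a b, ∃ w, act w x ≠ x) (hc : a < c) (hd : d < b) :
    ∃ h, d < act h c := by
  by_contra! hcon
  have hlub := isLUB_sSup (Set.range fun h => act h c)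
  set s := sSup (Set.range fun h => act h c)
  have h1 : c ≤ s := hlub.1 ⟨1, by simp⟩
  have h2 : s ≤ d := hlub.2 (by rintro _ ⟨h, rfl⟩; exact hcon h)
  obtain ⟨w, hw⟩ := hno s ⟨hc.trans_le h1, h2.trans_lt hd⟩
  apply hw
  have himg := (act w).isLUB_image'.2 hlub
  have hset : act w '' (Set.range fun h => act h c) = Set.range fun h => act h c := by
    ext y
    constructor
    · rintro ⟨_, ⟨h, rfl⟩, rfl⟩
      exact ⟨w * h, by simp [map_mul]⟩
    · rintro ⟨h, rfl⟩
      refine ⟨act (w⁻¹ * h) c, ⟨_, rfl⟩, ?_⟩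
      change (act w * act (w⁻¹ * h)) c = _
      rw [← map_mul, mul_inv_cancel_left]
  rw [hset] at himg
  exact himg.unique hlub

/-- If both generators have their breakpoints in `D`, then every component of the complement of
their common fixed points contains a point of `D`: otherwise both are affine on the component, and
fix its end points. -/
theorem IsComplComponent.exists_mem_breaks {f g : I ≃o I} {D : Finset I} (hf : HasDyadicBreaks f D)
    (hg : HasDyadicBreaks g D) {a b : I}
    (h : IsComplComponent {x | f x = x ∧ g x = x} a b) : ∃ d ∈ D, d ∈ Set.Ioo a b := by
  by_contra! hcon
  have key : ∀ f : I ≃o I, HasDyadicBreaks f D → f a = a → f b = b →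
      ∀ y ∈ Set.Icc a b, f y = y := by
    intro f hf ha hb y hy
    obtain ⟨k, hk⟩ := hf a b h.lt hcon
    have hb' := hk b ⟨h.lt.le, le_rfl⟩
    have hab : (a : ℝ) < b := h.lt
    rw [ha, hb] at hb'
    have h1 : (2 : ℝ) ^ k = 1 :=
      mul_right_cancel₀ (sub_ne_zero.2 hab.ne') (by rw [← hb', one_mul])
    have hy' := hk y hy
    rw [ha, h1, one_mul] at hy'
    exact Subtype.ext (by linarith)
  obtain ⟨y, hy⟩ := exists_between h.lt
  exact h.notMem y hy ⟨key f hf h.left_mem.1 h.right_mem.1 y ⟨hy.1.le, hy.2.le⟩,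
    key g hg h.left_mem.2 h.right_mem.2 y ⟨hy.1.le, hy.2.le⟩⟩

/-- The theorem of Brin and Squier for Thompson's group. -/
theorem not_containsNonabelianFree_thompsonF : ¬ ContainsNonabelianFree thompsonF := by
  classical
  rintro ⟨φ, hφ⟩
  let act : FreeGroup (Fin 2) →* (I ≃o I) := thompsonF.subtype.comp φ
  have hact : Function.Injective act := Subtype.val_injective.comp hφ
  have hT : ∀ w, IsThompson (act w) := fun w => (φ w).2
  set f := act (FreeGroup.of 0) with hf
  set g := act (FreeGroup.of 1) with hg
  obtain ⟨Df, -, hDf⟩ := hT (FreeGroup.of 0)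
  obtain ⟨Dg, -, hDg⟩ := hT (FreeGroup.of 1)
  have mono : ∀ {f : I ≃o I} {D D' : Finset I}, D ⊆ D' → HasDyadicBreaks f D →
      HasDyadicBreaks f D' := fun hDD' h a b hab hd => h a b hab fun d hdD => hd d (hDD' hdD)
  set D := Df ∪ Dg with hD
  have hDf' : HasDyadicBreaks f D := mono Finset.subset_union_left hDf
  have hDg' : HasDyadicBreaks g D := mono Finset.subset_union_right hDg
  set E : Set I := {x | f x = x ∧ g x = x} with hE
  have hEc : IsClosed E := (isClosed_eq f.continuous continuous_id).inter
    (isClosed_eq g.continuous continuous_id)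
  have fix : ∀ x ∈ E, ∀ w, act w x = x := by
    intro x hx w
    induction w using FreeGroup.induction_on with
    | C1 => simp
    | of i =>
      fin_cases i
      · exact hx.1
      · exact hx.2
    | inv_of i hi =>
      rw [map_inv]
      change (act _).symm x = x
      rw [OrderIso.symm_apply_eq, hi]
    | mul v w hv hw =>
      rw [map_mul, RelIso.mul_apply, hw, hv]
  have h0 : (0 : I) ∈ E := ⟨f.map_bot, g.map_bot⟩
  have h1 : (1 : I) ∈ E := ⟨f.map_top, g.map_top⟩
  -- the breakpoints lying in the components on which `w` acts nontrivially
  let bad : FreeGroup (Fin 2) → Finset I := fun w =>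
    D.filter fun d => ∃ a b, IsComplComponent E a b ∧ d ∈ Set.Ioo a b ∧
      ∃ x ∈ Set.Ioo a b, act w x ≠ x
  -- induction on the number of such breakpoints: a nontrivial commutator yields another commutator
  -- that acts trivially on one more component
  have main : ∀ n : ℕ, ∀ u v : FreeGroup (Fin 2), (bad ⁅u, v⁆).card = n → ⁅u, v⁆ = 1 := by
    intro n
    induction n using Nat.strong_induction_on with
    | _ n ih =>
      intro u v hn
      by_contra hne
      set w := ⁅u, v⁆ with hw
      obtain ⟨x, hx⟩ : ∃ x, act w x ≠ x := by
        by_contra! hc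
        exact hne (hact (by rw [map_one]; exact OrderIso.ext (funext hc)))
      have hxE : x ∉ E := fun h => hx (fix x h w)
      obtain ⟨a, b, hab, hxab⟩ := exists_isComplComponent hEc h0 h1 hxE
      obtain ⟨c, d, hac, hdb, hcd⟩ := exists_commutatorElement_fix act hT hab.lt
        (fix a hab.left_mem) (fix b hab.right_mem) u v
      rw [← hw] at hcd
      obtain ⟨h, hh⟩ := exists_lt_apply_of_no_fixed act (a := a) (b := b) (c := c) (d := d) (by
        intro y hy
        by_contra! hc
        exact hab.notMem y hy ⟨hc _, hc _⟩) hac hdb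
      set w' := h * w * h⁻¹ with hw'
      have hw'_apply : ∀ z, act w' z = act h (act w ((act h).symm z)) :=
        map_mul_inv_apply act h w
      have maps : ∀ {a b : I}, a ∈ E → b ∈ E → ∀ w, ∀ z ∈ Set.Icc a b, act w z ∈ Set.Icc a b := by
        intro a b ha hb w z hz
        exact ⟨by rw [← fix a ha w]; exact (act w).le_iff_le.2 hz.1,
          by rw [← fix b hb w]; exact (act w).le_iff_le.2 hz.2⟩
      have maps_symm : ∀ {a b : I}, a ∈ E → b ∈ E → ∀ w, ∀ z ∈ Set.Icc a b,
          (act w).symm z ∈ Set.Icc a b := by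
        intro a b ha hb w z hz
        have := maps ha hb w⁻¹ z hz
        rwa [map_inv] at this
      -- `w` is supported in `(c, d)`, and its conjugate `w'` to the right of `d`
      have hsw : ∀ z ∈ Set.Icc a b, d ≤ z → act w z = z := fun z hz hdz => hcd z hz (Or.inr hdz)
      have hsw' : ∀ z ∈ Set.Icc a b, z ≤ d → act w' z = z := by
        intro z hz hzd
        rw [hw'_apply, hcd _ (maps_symm hab.left_mem hab.right_mem h z hz) (Or.inl ?_),
          OrderIso.apply_symm_apply]
        rw [OrderIso.symm_apply_le]
        exact hzd.trans hh.le
      have hdab : d ∈ Set.Icc a b := by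
        refine ⟨?_, hdb.le⟩
        by_contra hc
        exact hx (hsw x ⟨hxab.1.le, hxab.2.le⟩ ((not_le.1 hc).le.trans hxab.1.le))
      have hwd : act w d = d := hsw d hdab le_rfl
      have hw'd : act w' d = d := hsw' d hdab le_rfl
      have hcomm : ∀ z ∈ Set.Icc a b, act w (act w' z) = act w' (act w z) := by
        intro z hz
        rcases le_total z d with hzd | hzd
        · have : act w z ≤ d := by rw [← hwd]; exact (act w).le_iff_le.2 hzd
          rw [hsw' z hz hzd, hsw' _ (maps hab.left_mem hab.right_mem w z hz) this]
        · have : d ≤ act w' z := by rw [← hw'd]; exact (act w').le_iff_le.2 hzd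
          rw [hsw z hz hzd, hsw _ (maps hab.left_mem hab.right_mem w' z hz) this]
      have hfix : ∀ z ∈ Set.Icc a b, act ⁅w, w'⁆ z = z := by
        intro z hz
        rw [map_commutatorElement_apply, hcomm _ (maps_symm hab.left_mem hab.right_mem _ _
          (maps_symm hab.left_mem hab.right_mem _ _ hz))]
        simp
      have hlt : (bad ⁅w, w'⁆).card < n := by
        rw [← hn]
        apply Finset.card_lt_card
        rw [Finset.ssubset_iff_of_subset]
        · obtain ⟨e, heD, heab⟩ := IsComplComponent.exists_mem_breaks hDf' hDg' hab
          refine ⟨e, Finset.mem_filter.2 ⟨heD, a, b, hab, heab, x, hxab, hx⟩, fun he => ?_⟩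
          obtain ⟨-, a', b', hab', heab', y, hy, hy'⟩ := Finset.mem_filter.1 he
          obtain ⟨rfl, rfl⟩ := hab.eq_of_mem hab' heab heab'
          exact hy' (hfix y ⟨hy.1.le, hy.2.le⟩)
        · intro e he
          obtain ⟨heD, a', b', hab', heab', y, hy, hy'⟩ := Finset.mem_filter.1 he
          refine Finset.mem_filter.2 ⟨heD, a', b', hab', heab', ?_⟩
          by_contra! hc
          have hc' : ∀ z ∈ Set.Icc a' b', act w z = z := by
            intro z hz
            rcases eq_or_lt_of_le hz.1 with rfl | h1
            · exact fix _ hab'.left_mem w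
            rcases eq_or_lt_of_le hz.2 with rfl | h2
            · exact fix _ hab'.right_mem w
            exact hc z ⟨h1, h2⟩
          have hc'' : ∀ z ∈ Set.Icc a' b', act w' z = z := by
            intro z hz
            rw [hw'_apply, hc' _ (maps_symm hab'.left_mem hab'.right_mem h z hz),
              OrderIso.apply_symm_apply]
          apply hy'
          have hyI : y ∈ Set.Icc a' b' := ⟨hy.1.le, hy.2.le⟩
          rw [map_commutatorElement_apply,
            (OrderIso.symm_apply_eq (act w')).2 (hc'' y hyI).symm,
            (OrderIso.symm_apply_eq (act w)).2 (hc' y hyI).symm, hc'' y hyI, hc' y hyI]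
      have hone := ih _ hlt w w' rfl
      -- `w` and `w'` commute in the free group, so they have a common power
      obtain ⟨p, q, hpq, heq⟩ := freeGroup_exists_zpow_eq_zpow_of_commute
        (commutatorElement_eq_one_iff_commute.1 hone)
      have hxd : x ≤ d := by
        by_contra hc
        exact hx (hsw x ⟨hxab.1.le, hxab.2.le⟩ (not_le.1 hc).le)
      have hw'x : act w' x = x := hsw' x ⟨hxab.1.le, hxab.2.le⟩ hxd
      have hw'q : (act w' ^ q) x = x := by
        have : act w' ∈ MulAction.stabilizer (I ≃o I) x := hw'x
        exact zpow_mem this q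
      have hp : p = 0 := by
        by_contra hp
        apply (act w).zpow_apply_ne hx hp
        rw [← map_zpow, heq, map_zpow, hw'q]
      subst hp
      rw [zpow_zero, hw', conj_zpow] at heq
      have hq : w ^ q = 1 := by simpa using heq.symm
      have hq0 : q ≠ 0 := by simpa using hpq
      apply (act w).zpow_apply_ne hx hq0
      rw [← map_zpow, hq]
      simp
  have h01 := main _ (FreeGroup.of 0) (FreeGroup.of 1) rfl
  rw [commutatorElement_eq_one_iff_commute] at h01
  have := congrArg FreeGroup.toWord h01.eq
  simp [FreeGroup.toWord_mul, FreeGroup.toWord_of, FreeGroup.reduce] at this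

end Groups

/-! ### Winding numbers under homotopies -/

/-- If, seen from their base points, two loops never point in directions that differ by a right
angle or more, then they have the same winding number: the angle between them is a continuous
function with values in `(-π/2, π/2)`. -/
theorem HasWindingNumber.of_inner_pos {γ γ' : C(I, ℝ × ℝ)} {p p' : ℝ × ℝ} {n : ℤ}
    (h : HasWindingNumber γ p n) (hγ' : γ' 0 = γ' 1)
    (hpos : ∀ t, 0 < ((γ t).1 - p.1) * ((γ' t).1 - p'.1) + ((γ t).2 - p.2) * ((γ' t).2 - p'.2)) :
    HasWindingNumber γ' p' n := by
  obtain ⟨r, θ, hr, hθ⟩ := h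
  set X : I → ℝ := fun t => (γ' t).1 - p'.1 with hX
  set Y : I → ℝ := fun t => (γ' t).2 - p'.2 with hY
  -- the coordinates of the second loop in the frame rotated by the angle of the first
  set u : I → ℝ := fun t => X t * Real.cos (θ t) + Y t * Real.sin (θ t) with hu
  set v : I → ℝ := fun t => Y t * Real.cos (θ t) - X t * Real.sin (θ t) with hv
  have hXc : Continuous X := by fun_prop
  have hYc : Continuous Y := by fun_prop
  have huc : Continuous u := by fun_prop
  have hvc : Continuous v := by fun_prop
  have hu0 : ∀ t, 0 < u t := by
    intro t
    have h1 := hpos t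
    rw [(hr t).2] at h1
    simp only [Prod.fst_add, Prod.snd_add, Prod.smul_fst, Prod.smul_snd, smul_eq_mul] at h1
    have h2 : 0 < r t * u t := by
      simp only [hu, hX, hY]
      linarith
    exact (pos_iff_pos_of_mul_pos h2).1 (hr t).1
  have hs : ∀ t, 0 < 1 + (v t / u t) ^ 2 := fun t => by positivity
  refine ⟨⟨fun t => u t * √(1 + (v t / u t) ^ 2), ?_⟩,
    ⟨fun t => θ t + Real.arctan (v t / u t), ?_⟩, fun t => ⟨?_, ?_⟩, ?_⟩
  · exact huc.mul ((continuous_const.add ((hvc.div huc fun t => (hu0 t).ne').pow 2)).sqrt)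
  · exact θ.continuous.add (Real.continuous_arctan.comp (hvc.div huc fun t => (hu0 t).ne'))
  · exact mul_pos (hu0 t) (Real.sqrt_pos.2 (hs t))
  · simp only [ContinuousMap.coe_mk]
    have hsq : √(1 + (v t / u t) ^ 2) ≠ 0 := (Real.sqrt_pos.2 (hs t)).ne'
    have hu' := (hu0 t).ne'
    have htrig := Real.sin_sq_add_cos_sq (θ t)
    rw [Real.cos_add, Real.sin_add, Real.cos_arctan, Real.sin_arctan]
    set c := Real.cos (θ t)
    set s := Real.sin (θ t)
    ext
    · have : (u t * √(1 + (v t / u t) ^ 2)) * (c * (1 / √(1 + (v t / u t) ^ 2)) -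
          s * (v t / u t / √(1 + (v t / u t) ^ 2))) = u t * c - v t * s := by
        field_simp
      simp only [Prod.fst_add, Prod.smul_fst, smul_eq_mul]
      rw [this]
      simp only [hu, hv, hX]
      linear_combination (-((γ' t).1 - p'.1)) * htrig
    · have : (u t * √(1 + (v t / u t) ^ 2)) * (s * (1 / √(1 + (v t / u t) ^ 2)) +
          c * (v t / u t / √(1 + (v t / u t) ^ 2))) = u t * s + v t * c := by
        field_simp
      simp only [Prod.snd_add, Prod.smul_snd, smul_eq_mul]
      rw [this]
      simp only [hu, hv, hY]
      linear_combination (-((γ' t).2 - p'.2)) * htrig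
  · simp only [ContinuousMap.coe_mk]
    have hX1 : X 1 = X 0 := by simp only [hX, hγ']
    have hY1 : Y 1 = Y 0 := by simp only [hY, hγ']
    have hu1 : u 1 = u 0 := by
      simp only [hu, hX1, hY1, hθ, Real.cos_add_int_mul_two_pi, Real.sin_add_int_mul_two_pi]
    have hv1 : v 1 = v 0 := by
      simp only [hv, hX1, hY1, hθ, Real.cos_add_int_mul_two_pi, Real.sin_add_int_mul_two_pi]
    rw [hu1, hv1, hθ]
    ring

/-- The winding number is invariant under free homotopies of loops around a moving base point. -/
theorem hasWindingNumber_iff_of_homotopy (H : C(I × I, ℝ × ℝ)) (P : C(I, ℝ × ℝ))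
    (hne : ∀ s t, H (s, t) ≠ P s) (hcl : ∀ s, H (s, 0) = H (s, 1)) {γ₀ γ₁ : C(I, ℝ × ℝ)}
    (h0 : ∀ t, H (0, t) = γ₀ t) (h1 : ∀ t, H (1, t) = γ₁ t) (n : ℤ) :
    HasWindingNumber γ₀ (P 0) n ↔ HasWindingNumber γ₁ (P 1) n := by
  have e0 : H.curry 0 = γ₀ := ContinuousMap.ext h0
  have e1 : H.curry 1 = γ₁ := ContinuousMap.ext h1
  rw [← e0, ← e1]
  have hloc : IsLocallyConstant fun s => HasWindingNumber (H.curry s) (P s) n := by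
    rw [IsLocallyConstant.iff_eventually_eq]
    intro s₀
    have hev : ∀ᶠ s in 𝓝 s₀, ∀ t ∈ (Set.univ : Set I),
        0 < ((H (s₀, t)).1 - (P s₀).1) * ((H (s, t)).1 - (P s).1) +
          ((H (s₀, t)).2 - (P s₀).2) * ((H (s, t)).2 - (P s).2) := by
      apply isCompact_univ.eventually_forall_of_forall_eventually
      intro t _
      have hc : Continuous fun z : I × I =>
          ((H (s₀, z.2)).1 - (P s₀).1) * ((H (z.1, z.2)).1 - (P z.1).1) +
          ((H (s₀, z.2)).2 - (P s₀).2) * ((H (z.1, z.2)).2 - (P z.1).2) := by fun_prop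
      refine hc.continuousAt.eventually (lt_mem_nhds ?_)
      change 0 < ((H (s₀, t)).1 - (P s₀).1) * ((H (s₀, t)).1 - (P s₀).1) +
          ((H (s₀, t)).2 - (P s₀).2) * ((H (s₀, t)).2 - (P s₀).2)
      by_contra hcon
      apply hne s₀ t
      ext <;> nlinarith [mul_self_nonneg ((H (s₀, t)).1 - (P s₀).1),
        mul_self_nonneg ((H (s₀, t)).2 - (P s₀).2)]
    filter_upwards [hev] with s hs
    apply propext
    constructor
    · intro h
      exact h.of_inner_pos (hcl s₀) fun t => by
        have := hs t trivial
        simp only [ContinuousMap.curry_apply]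
        linarith
    · intro h
      exact h.of_inner_pos (hcl s) fun t => by
        have := hs t trivial
        simp only [ContinuousMap.curry_apply]
        linarith
  exact iff_of_eq (hloc.apply_eq_of_isPreconnected isPreconnected_univ trivial trivial)

/-- A loop of winding number one around `p` is not contained in the half plane to the right of
`p`. -/
theorem HasWindingNumber.exists_fst_le {γ : C(I, ℝ × ℝ)} {p : ℝ × ℝ}
    (h : HasWindingNumber γ p 1) : ∃ t, (γ t).1 ≤ p.1 := by
  by_contra! hcon
  obtain ⟨r, θ, hr, hθ⟩ := h
  have hcos : ∀ t, 0 < Real.cos (θ t) := by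
    intro t
    have h1 := hcon t
    rw [(hr t).2] at h1
    simp only [Prod.fst_add, Prod.smul_fst, smul_eq_mul] at h1
    exact (pos_iff_pos_of_mul_pos (by linarith : 0 < r t * Real.cos (θ t))).1 (hr t).1
  -- at some time the angle has grown by `π`, so that the cosine has changed its sign
  obtain ⟨t, ht⟩ := mem_range_of_exists_le_of_exists_ge θ.continuous
    (c := θ 0 + Real.pi) ⟨0, by linarith [Real.pi_pos]⟩
    ⟨1, by rw [hθ]; push_cast; linarith [Real.pi_pos]⟩
  have h1 := hcos t
  have h2 := hcos 0
  rw [ht, Real.cos_add_pi] at h1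
  linarith

/-! ### Homeomorphisms moving points horizontally -/

/-- A strictly increasing self-map of the line, applied to the first coordinate, is isotopic to the
identity by convex combinations, so it preserves winding numbers. -/
theorem isOrientationPreserving_of_fst {S : Set (ℝ × ℝ)} (h : S ≃ₜ S) (G : ℝ ≃o ℝ)
    (hG : ∀ p : S, (h p : ℝ × ℝ) = (G (p : ℝ × ℝ).1, (p : ℝ × ℝ).2)) :
    IsOrientationPreserving h := by
  intro x
  refine ⟨Set.univ, Filter.univ_mem, fun γ hγ hx n => ?_⟩
  have hGc : Continuous G := G.continuous
  let H : C(I × I, ℝ × ℝ) :=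
    ⟨fun z => ((1 - (z.1 : ℝ)) * (γ z.2 : ℝ × ℝ).1 + z.1 * G (γ z.2 : ℝ × ℝ).1,
      (γ z.2 : ℝ × ℝ).2), by fun_prop⟩
  let P : C(I, ℝ × ℝ) :=
    ⟨fun s => ((1 - (s : ℝ)) * (x : ℝ × ℝ).1 + s * G (x : ℝ × ℝ).1, (x : ℝ × ℝ).2), by fun_prop⟩
  have key := hasWindingNumber_iff_of_homotopy H P ?_ ?_ (γ₀ := planePath γ)
    (γ₁ := planePath ((h : C(S, S)).comp γ)) ?_ ?_ n
  · have e0 : P 0 = x := by simp [P]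
    have e1 : P 1 = h x := by simp [P, hG]
    rwa [e0, e1] at key
  · intro s t heq
    have h2 : (γ t : ℝ × ℝ).2 = (x : ℝ × ℝ).2 := by
      simpa [H, P] using congrArg Prod.snd heq
    have h1 : (1 - (s : ℝ)) * (γ t : ℝ × ℝ).1 + s * G (γ t : ℝ × ℝ).1 =
      (1 - (s : ℝ)) * (x : ℝ × ℝ).1 + s * G (x : ℝ × ℝ).1 := congrArg Prod.fst heq
    apply (hx t).2
    apply Subtype.ext
    refine Prod.ext ?_ h2
    have mono : StrictMono fun a : ℝ => (1 - (s : ℝ)) * a + s * G a := by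
      intro a b hab
      have hGab : G a < G b := G.lt_iff_lt.2 hab
      have hs0 := s.2.1
      have hs1 := s.2.2
      rcases eq_or_lt_of_le hs0 with h0 | h0
      · simp only [← h0]
        linarith
      · have := mul_lt_mul_of_pos_left hGab h0
        have := mul_le_mul_of_nonneg_left hab.le (sub_nonneg.2 hs1)
        change (1 - (s : ℝ)) * a + s * G a < (1 - (s : ℝ)) * b + s * G b
        linarith
    exact mono.injective h1
  · intro s
    simp [H, hγ]
  · intro t
    simp [H, planePath]
  · intro t
    simp [H, planePath, hG]

/-- A homeomorphism that moves points horizontally by `G` is not homotopic to the identity in the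
complement of a set `C` if `G` moves a point `q` with `(q, 0) ∈ C` to the right. Around such a `q`
there is a circle that winds once around `(q, 0)` and meets the axis outside of `C`, and whose image
lies to the right of `(q, 0)`. -/
theorem not_homotopic_id_of_fst {C : Set (ℝ × ℝ)} (hC : ∀ p ∈ C, p.2 = 0)
    (h : (Cᶜ : Set (ℝ × ℝ)) ≃ₜ (Cᶜ : Set (ℝ × ℝ))) (G : ℝ ≃o ℝ)
    (hG : ∀ p : (Cᶜ : Set (ℝ × ℝ)), (h p : ℝ × ℝ) = (G (p : ℝ × ℝ).1, (p : ℝ × ℝ).2))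
    {u q v : ℝ} (hu : (u, (0 : ℝ)) ∉ C) (hq : (q, (0 : ℝ)) ∈ C) (hv : (v, (0 : ℝ)) ∉ C)
    (huq : u < q) (hqv : q < v) (hqu : q < G u) :
    ¬ ContinuousMap.Homotopic (h : C((Cᶜ : Set (ℝ × ℝ)), (Cᶜ : Set (ℝ × ℝ))))
      (ContinuousMap.id _) := by
  rintro ⟨F⟩
  set m : ℝ := (u + v) / 2 with hm
  set ρ : ℝ := (v - u) / 2 with hρ
  have hρ0 : 0 < ρ := by linarith
  let c : I → ℝ := fun t => Real.cos (2 * Real.pi * t)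
  let s : I → ℝ := fun t => Real.sin (2 * Real.pi * t)
  have hcs : ∀ t, s t ^ 2 + c t ^ 2 = 1 := fun t => Real.sin_sq_add_cos_sq _
  have hc1 : ∀ t, -1 ≤ c t := fun t => Real.neg_one_le_cos _
  have hcc : Continuous c := by fun_prop
  have hsc : Continuous s := by fun_prop
  have hmem : ∀ t, (m + ρ * c t, ρ * s t) ∈ Cᶜ := by
    intro t ht
    have h1 : ρ * s t = 0 := hC _ ht
    have h2 : s t = 0 := (mul_eq_zero.1 h1).resolve_left hρ0.ne'
    have h3 : (c t - 1) * (c t + 1) = 0 := by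
      have := hcs t
      rw [h2] at this
      linarith
    rw [h1] at ht
    rcases mul_eq_zero.1 h3 with h4 | h4
    · apply hv
      convert ht using 2
      rw [show c t = 1 by linarith]
      ring
    · apply hu
      convert ht using 2
      rw [show c t = -1 by linarith]
      ring
  let γ : C(I, (Cᶜ : Set (ℝ × ℝ))) := ⟨fun t => ⟨(m + ρ * c t, ρ * s t), hmem t⟩, by fun_prop⟩
  have hγ01 : γ 0 = γ 1 := by
    apply Subtype.ext
    simp [γ, c, s]
  have w0 : HasWindingNumber (planePath γ) (m, 0) 1 := by
    refine ⟨ContinuousMap.const _ ρ, ⟨fun t => 2 * Real.pi * t, by fun_prop⟩,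
      fun t => ⟨hρ0, ?_⟩, ?_⟩
    · ext <;> simp [planePath, γ, c, s]
    · simp
  have w1 : HasWindingNumber (planePath γ) (q, 0) 1 := by
    have key := hasWindingNumber_iff_of_homotopy
      ⟨fun z : I × I => (γ z.2 : ℝ × ℝ), by fun_prop⟩
      ⟨fun a : I => (((1 - (a : ℝ)) * m + a * q, 0) : ℝ × ℝ), by fun_prop⟩ ?_ ?_
      (γ₀ := planePath γ) (γ₁ := planePath γ) ?_ ?_ 1
    · simpa [w0] using key
    · intro a t heq
      have h1 : m + ρ * c t = (1 - (a : ℝ)) * m + a * q := congrArg Prod.fst heq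
      have h2 : ρ * s t = 0 := congrArg Prod.snd heq
      have h3 : (ρ * c t) ^ 2 = ρ ^ 2 := by
        have := hcs t
        linear_combination ρ ^ 2 * this - (ρ * s t) * h2
      have h4 : ρ * c t = a * (q - m) := by linarith
      rw [h4] at h3
      have ha0 := a.2.1
      have ha1 := a.2.2
      have h5 : |(a : ℝ) * (q - m)| < ρ := by
        rw [abs_mul, abs_of_nonneg ha0]
        have h6 : |q - m| < ρ := by rw [abs_lt]; constructor <;> linarith
        calc (a : ℝ) * |q - m| ≤ 1 * |q - m| := by gcongr
          _ < ρ := by linarith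
      exact absurd h3 (sq_lt_sq.2 (h5.trans_le (le_abs_self _))).ne
    · intro a
      simp only [ContinuousMap.coe_mk, hγ01]
    · intro t; rfl
    · intro t; rfl
  have w2 : HasWindingNumber
      (planePath ((h : C((Cᶜ : Set (ℝ × ℝ)), (Cᶜ : Set (ℝ × ℝ)))).comp γ)) (q, 0) 1 := by
    refine (hasWindingNumber_iff_of_homotopy
      ⟨fun z : I × I => (F (z.1, γ z.2) : ℝ × ℝ), by fun_prop⟩ (ContinuousMap.const _ (q, 0))
      ?_ ?_ ?_ ?_ 1).2 w1
    · intro a t heq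
      exact (F (a, γ t)).2 (by rw [show ((F (a, γ t)) : ℝ × ℝ) = (q, 0) from heq]; exact hq)
    · intro a
      simp only [ContinuousMap.coe_mk, hγ01]
    · intro t
      simp [planePath]
    · intro t
      simp [planePath]
  obtain ⟨t, ht⟩ := w2.exists_fst_le
  have e : (planePath ((h : C((Cᶜ : Set (ℝ × ℝ)), (Cᶜ : Set (ℝ × ℝ)))).comp γ) t).1 =
      G (m + ρ * c t) := by
    change (h (γ t) : ℝ × ℝ).1 = _
    rw [hG]
    rfl
  rw [e] at ht
  have : G u ≤ G (m + ρ * c t) := by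
    rw [G.le_iff_le]
    nlinarith [hc1 t]
  linarith

/-! ### Fibres of monotone surjections of the line, and lifts -/

section Lift

variable {ψ : ℝ → ℝ}

/-- The left end point of the fibre of `ψ` over `y`. -/
noncomputable def fibreLo (ψ : ℝ → ℝ) (y : ℝ) : ℝ := sInf (ψ ⁻¹' {y})

/-- The right end point of the fibre of `ψ` over `y`. -/
noncomputable def fibreHi (ψ : ℝ → ℝ) (y : ℝ) : ℝ := sSup (ψ ⁻¹' {y})

theorem isCompact_fibre (hm : Monotone ψ) (hs : Function.Surjective ψ) (y : ℝ) :
    IsCompact (ψ ⁻¹' {y}) := by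
  obtain ⟨a, ha⟩ := hs (y - 1)
  obtain ⟨b, hb⟩ := hs (y + 1)
  refine isCompact_Icc.of_isClosed_subset (isClosed_singleton.preimage
    (hm.continuous_of_surjective hs)) (fun x hx => (⟨?_, ?_⟩ : x ∈ Set.Icc a b))
  · exact (hm.reflect_lt (by rw [ha, show ψ x = y from hx]; linarith)).le
  · exact (hm.reflect_lt (by rw [hb, show ψ x = y from hx]; linarith)).le

theorem apply_fibreLo (hm : Monotone ψ) (hs : Function.Surjective ψ) (y : ℝ) :
    ψ (fibreLo ψ y) = y :=
  (isCompact_fibre hm hs y).sInf_mem (hs y)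

theorem apply_fibreHi (hm : Monotone ψ) (hs : Function.Surjective ψ) (y : ℝ) :
    ψ (fibreHi ψ y) = y :=
  (isCompact_fibre hm hs y).sSup_mem (hs y)

theorem fibreLo_le (hm : Monotone ψ) (hs : Function.Surjective ψ) {x y : ℝ} (h : ψ x = y) :
    fibreLo ψ y ≤ x :=
  csInf_le (isCompact_fibre hm hs y).bddBelow h

theorem le_fibreHi (hm : Monotone ψ) (hs : Function.Surjective ψ) {x y : ℝ} (h : ψ x = y) :
    x ≤ fibreHi ψ y :=
  le_csSup (isCompact_fibre hm hs y).bddAbove h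

theorem fibreLo_le_fibreHi (hm : Monotone ψ) (hs : Function.Surjective ψ) (y : ℝ) :
    fibreLo ψ y ≤ fibreHi ψ y :=
  fibreLo_le hm hs (apply_fibreHi hm hs y)

theorem apply_eq_of_mem_fibre (hm : Monotone ψ) (hs : Function.Surjective ψ) {x y : ℝ}
    (h1 : fibreLo ψ y ≤ x) (h2 : x ≤ fibreHi ψ y) : ψ x = y := by
  apply le_antisymm
  · rw [← apply_fibreHi hm hs y]
    exact hm h2
  · rw [← apply_fibreLo hm hs y]
    exact hm h1

/-- The lift along `ψ` of a self-map `g` of the line: it carries the fibre over `y` affinely onto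
the fibre over `g y`. Over a degenerate fibre the quotient is `0 / 0 = 0`, as it should. -/
noncomputable def liftFun (ψ g : ℝ → ℝ) (x : ℝ) : ℝ :=
  fibreLo ψ (g (ψ x)) + (x - fibreLo ψ (ψ x)) / (fibreHi ψ (ψ x) - fibreLo ψ (ψ x)) *
    (fibreHi ψ (g (ψ x)) - fibreLo ψ (g (ψ x)))

theorem apply_liftFun (hm : Monotone ψ) (hs : Function.Surjective ψ) (g : ℝ → ℝ) (x : ℝ) :
    ψ (liftFun ψ g x) = g (ψ x) := by
  have h1 := fibreLo_le hm hs (rfl : ψ x = ψ x)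
  have h2 := le_fibreHi hm hs (rfl : ψ x = ψ x)
  have h3 := fibreLo_le_fibreHi hm hs (g (ψ x))
  have h4 : 0 ≤ (x - fibreLo ψ (ψ x)) / (fibreHi ψ (ψ x) - fibreLo ψ (ψ x)) :=
    div_nonneg (by linarith) (by linarith)
  have h5 : (x - fibreLo ψ (ψ x)) / (fibreHi ψ (ψ x) - fibreLo ψ (ψ x)) ≤ 1 :=
    div_le_one_of_le₀ (by linarith) (by linarith)
  apply apply_eq_of_mem_fibre hm hs
  · unfold liftFun
    nlinarith
  · unfold liftFun
    nlinarith

theorem liftFun_monotone (hm : Monotone ψ) (hs : Function.Surjective ψ) {g : ℝ → ℝ}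
    (hg : StrictMono g) : Monotone (liftFun ψ g) := by
  intro x y hxy
  rcases eq_or_lt_of_le (hm hxy) with heq | hlt
  · unfold liftFun
    rw [heq]
    have h3 := fibreLo_le_fibreHi hm hs (g (ψ y))
    have h4 := fibreLo_le_fibreHi hm hs (ψ y)
    gcongr
  · refine (hm.reflect_lt ?_).le
    rw [apply_liftFun hm hs, apply_liftFun hm hs]
    exact hg hlt

theorem liftFun_liftFun (hm : Monotone ψ) (hs : Function.Surjective ψ) (g h : ℝ → ℝ)
    (hh : ∀ y, fibreLo ψ y < fibreHi ψ y ↔ fibreLo ψ (h y) < fibreHi ψ (h y)) (x : ℝ) :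
    liftFun ψ g (liftFun ψ h x) = liftFun ψ (g ∘ h) x := by
  have e := apply_liftFun hm hs h x
  rw [liftFun, e, liftFun, liftFun, Function.comp_apply]
  rcases eq_or_lt_of_le (fibreLo_le_fibreHi hm hs (ψ x)) with h1 | h1
  · have h2 : fibreLo ψ (h (ψ x)) = fibreHi ψ (h (ψ x)) := by
      by_contra hne
      exact absurd ((hh _).2 (lt_of_le_of_ne (fibreLo_le_fibreHi hm hs _) hne)) h1.not_lt
    rw [h1, h2]
    simp
  · have h2 := (hh _).1 h1
    have h3 : fibreHi ψ (h (ψ x)) - fibreLo ψ (h (ψ x)) ≠ 0 := by linarith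
    rw [add_sub_cancel_left, mul_div_assoc, div_self h3, mul_one]

theorem liftFun_of_fixed (hm : Monotone ψ) (hs : Function.Surjective ψ) {g : ℝ → ℝ} {x : ℝ}
    (h : g (ψ x) = ψ x) : liftFun ψ g x = x := by
  rw [liftFun, h]
  rcases eq_or_lt_of_le (fibreLo_le_fibreHi hm hs (ψ x)) with h1 | h1
  · have h2 := fibreLo_le hm hs (rfl : ψ x = ψ x)
    have h3 := le_fibreHi hm hs (rfl : ψ x = ψ x)
    rw [h1]
    simp only [sub_self, mul_zero, add_zero]
    linarith
  · have h3 : fibreHi ψ (ψ x) - fibreLo ψ (ψ x) ≠ 0 := by linarith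
    field_simp
    ring

end Lift

/-! ### Extension from the unit interval to the line -/

open Classical in
/-- A self-map of the unit interval, extended by the identity. -/
noncomputable def extendFun (f : I → I) (x : ℝ) : ℝ :=
  if h : x ∈ Set.Icc (0 : ℝ) 1 then f ⟨x, h⟩ else x

theorem extendFun_of_mem (f : I → I) {x : ℝ} (h : x ∈ Set.Icc (0 : ℝ) 1) :
    extendFun f x = f ⟨x, h⟩ := dif_pos h

theorem extendFun_of_notMem (f : I → I) {x : ℝ} (h : x ∉ Set.Icc (0 : ℝ) 1) :
    extendFun f x = x := dif_neg h

theorem extendFun_extendFun (f g : I → I) (x : ℝ) :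
    extendFun f (extendFun g x) = extendFun (f ∘ g) x := by
  by_cases h : x ∈ Set.Icc (0 : ℝ) 1
  · rw [extendFun_of_mem g h, extendFun_of_mem _ h, extendFun_of_mem f (g ⟨x, h⟩).2]
    rfl
  · rw [extendFun_of_notMem g h, extendFun_of_notMem _ h, extendFun_of_notMem _ h]

theorem extendFun_id (x : ℝ) : extendFun id x = x := by
  by_cases h : x ∈ Set.Icc (0 : ℝ) 1
  · rw [extendFun_of_mem _ h]
    rfl
  · exact extendFun_of_notMem _ h

theorem extendFun_mem (f : I → I) {x : ℝ} (h : x ∈ Set.Icc (0 : ℝ) 1) :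
    extendFun f x ∈ Set.Icc (0 : ℝ) 1 := by
  rw [extendFun_of_mem f h]
  exact (f ⟨x, h⟩).2

theorem extendFun_strictMono (f : I ≃o I) : StrictMono (extendFun f) := by
  intro x y hxy
  by_cases hx : x ∈ Set.Icc (0 : ℝ) 1 <;> by_cases hy : y ∈ Set.Icc (0 : ℝ) 1
  · rw [extendFun_of_mem _ hx, extendFun_of_mem _ hy]
    exact f.lt_iff_lt.2 hxy
  · rw [extendFun_of_notMem _ hy]
    have h1 := extendFun_mem f hx
    have : 1 < y := by
      by_contra hc
      exact hy ⟨hx.1.trans hxy.le, not_lt.1 hc⟩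
    exact h1.2.trans_lt this
  · rw [extendFun_of_notMem _ hx]
    have h1 := extendFun_mem f hy
    have : x < 0 := by
      by_contra hc
      exact hx ⟨not_lt.1 hc, hxy.le.trans hy.2⟩
    exact this.trans_le h1.1
  · rwa [extendFun_of_notMem _ hx, extendFun_of_notMem _ hy]

theorem extendFun_of_notMem_Ioo (f : I ≃o I) {x : ℝ} (h : x ∉ Set.Ioo (0 : ℝ) 1) :
    extendFun f x = x := by
  by_cases hx : x ∈ Set.Icc (0 : ℝ) 1
  · rcases eq_or_lt_of_le hx.1 with rfl | h0
    · rw [extendFun_of_mem _ hx]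
      exact congrArg Subtype.val f.map_bot
    · have h1 : x = 1 := le_antisymm hx.2 (not_lt.1 fun h1 => h ⟨h0, h1⟩)
      subst h1
      rw [extendFun_of_mem _ hx]
      exact congrArg Subtype.val f.map_top
  · exact extendFun_of_notMem _ hx

/-! ### Staircases -/

/-- A staircase over a subset `K` of the unit interval: a monotone map of the line onto itself whose
nondegenerate fibres are those over the dyadic rationals in `(0,1)`, and such that `K` consists of
the points over `[0,1]` that are not interior to a fibre. The points over `(0,1)` belong to the unit
interval, so that lifts of maps supported in `(0,1)` are supported in the unit interval. -/
structure IsStaircase (ψ : ℝ → ℝ) (K : Set ℝ) : Prop where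
  mono : Monotone ψ
  surj : Function.Surjective ψ
  fibre_iff : ∀ y, (∃ x x', x < x' ∧ ψ x = y ∧ ψ x' = y) ↔ 0 < y ∧ y < 1 ∧ IsDyadic y
  mem_iff : ∀ x, x ∈ K ↔ 0 ≤ ψ x ∧ ψ x ≤ 1 ∧ ¬ ∃ p q, p < x ∧ x < q ∧ ψ p = ψ q
  mem_Icc : ∀ x, 0 < ψ x → ψ x < 1 → x ∈ Set.Icc (0 : ℝ) 1

namespace IsStaircase

variable {ψ : ℝ → ℝ} {K : Set ℝ}

theorem fibreLo_lt_iff (h : IsStaircase ψ K) (y : ℝ) :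
    fibreLo ψ y < fibreHi ψ y ↔ 0 < y ∧ y < 1 ∧ IsDyadic y := by
  rw [← h.fibre_iff]
  constructor
  · intro hlt
    exact ⟨_, _, hlt, apply_fibreLo h.mono h.surj y, apply_fibreHi h.mono h.surj y⟩
  · rintro ⟨x, x', hlt, h1, h2⟩
    exact ((fibreLo_le h.mono h.surj h1).trans_lt hlt).trans_le (le_fibreHi h.mono h.surj h2)

theorem fibreLo_lt_iff_extendFun (h : IsStaircase ψ K) {f : I ≃o I} (hf : IsThompson f) (y : ℝ) :
    fibreLo ψ y < fibreHi ψ y ↔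
      fibreLo ψ (extendFun f y) < fibreHi ψ (extendFun f y) := by
  rw [h.fibreLo_lt_iff, h.fibreLo_lt_iff]
  have h0 : extendFun f 0 = 0 := extendFun_of_notMem_Ioo f (by simp)
  have h1 : extendFun f 1 = 1 := extendFun_of_notMem_Ioo f (by simp)
  have e0 : 0 < extendFun f y ↔ 0 < y := by
    rw [← (extendFun_strictMono f).lt_iff_lt (a := 0) (b := y), h0]
  have e1 : extendFun f y < 1 ↔ y < 1 := by
    rw [← (extendFun_strictMono f).lt_iff_lt (a := y) (b := 1), h1]
  rw [e0, e1]
  refine and_congr_right fun hy0 => and_congr_right fun hy1 => ?_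
  have hy : y ∈ Set.Icc (0 : ℝ) 1 := ⟨hy0.le, hy1.le⟩
  rw [extendFun_of_mem _ hy, hf.dyadic_iff]

theorem liftFun_inv_liftFun (h : IsStaircase ψ K) (f : thompsonF) (x : ℝ) :
    liftFun ψ (extendFun ((f⁻¹ : thompsonF) : I ≃o I)) (liftFun ψ (extendFun (f : I ≃o I)) x) =
      x := by
  rw [liftFun_liftFun h.mono h.surj _ _ (h.fibreLo_lt_iff_extendFun f.2)]
  apply liftFun_of_fixed h.mono h.surj
  rw [Function.comp_apply, extendFun_extendFun]
  refine Eq.trans (congrArg (fun F => extendFun F (ψ x)) ?_) (extendFun_id _)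
  exact funext fun y => (f : I ≃o I).symm_apply_apply y

/-- The action of Thompson's group on the line by lifts along a staircase. -/
noncomputable def lineAction (h : IsStaircase ψ K) : thompsonF →* (ℝ ≃o ℝ) where
  toFun f := Equiv.toOrderIso
    { toFun := liftFun ψ (extendFun (f : I ≃o I))
      invFun := liftFun ψ (extendFun ((f⁻¹ : thompsonF) : I ≃o I))
      left_inv := h.liftFun_inv_liftFun f
      right_inv := fun x => by simpa using h.liftFun_inv_liftFun f⁻¹ x }
    (liftFun_monotone h.mono h.surj (extendFun_strictMono _))
    (liftFun_monotone h.mono h.surj (extendFun_strictMono _))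
  map_one' := by
    ext x
    exact liftFun_of_fixed h.mono h.surj (extendFun_id _)
  map_mul' f g := by
    ext x
    change liftFun ψ _ x = liftFun ψ _ (liftFun ψ _ x)
    rw [liftFun_liftFun h.mono h.surj _ _ (h.fibreLo_lt_iff_extendFun g.2)]
    congr 1
    funext y
    rw [Function.comp_apply, extendFun_extendFun]
    rfl

theorem lineAction_apply (h : IsStaircase ψ K) (f : thompsonF) (x : ℝ) :
    h.lineAction f x = liftFun ψ (extendFun (f : I ≃o I)) x := rfl

theorem apply_lineAction (h : IsStaircase ψ K) (f : thompsonF) (x : ℝ) :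
    ψ (h.lineAction f x) = extendFun (f : I ≃o I) (ψ x) :=
  apply_liftFun h.mono h.surj _ _

theorem lineAction_of_notMem (h : IsStaircase ψ K) (f : thompsonF) {x : ℝ}
    (hx : x ∉ Set.Icc (0 : ℝ) 1) : h.lineAction f x = x :=
  liftFun_of_fixed h.mono h.surj
    (extendFun_of_notMem_Ioo _ fun h' => hx (h.mem_Icc x h'.1 h'.2))

theorem lineAction_mem (h : IsStaircase ψ K) (f : thompsonF) {x : ℝ} (hx : x ∈ K) :
    h.lineAction f x ∈ K := by
  rw [h.mem_iff] at hx ⊢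
  rw [h.apply_lineAction]
  have hm := extendFun_mem (f : I ≃o I) (show ψ x ∈ Set.Icc (0 : ℝ) 1 from ⟨hx.1, hx.2.1⟩)
  refine ⟨hm.1, hm.2, ?_⟩
  rintro ⟨p, q, hp, hq, hpq⟩
  refine hx.2.2 ⟨(h.lineAction f).symm p, (h.lineAction f).symm q,
    (OrderIso.symm_apply_lt _).2 hp, (OrderIso.lt_symm_apply _).2 hq, ?_⟩
  apply (extendFun_strictMono (f : I ≃o I)).injective
  rw [← h.apply_lineAction, ← h.apply_lineAction, OrderIso.apply_symm_apply,
    OrderIso.apply_symm_apply, hpq]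

theorem lineAction_inv_apply (h : IsStaircase ψ K) (f : thompsonF) (x : ℝ) :
    h.lineAction f (h.lineAction f⁻¹ x) = x := by
  rw [map_inv]
  exact (h.lineAction f).apply_symm_apply x

theorem lineAction_mem_iff (h : IsStaircase ψ K) (f : thompsonF) (x : ℝ) :
    h.lineAction f x ∈ K ↔ x ∈ K := by
  refine ⟨fun hx => ?_, h.lineAction_mem f⟩
  have := h.lineAction_mem f⁻¹ hx
  have e := h.lineAction_inv_apply f⁻¹ x
  rw [inv_inv] at e
  rwa [e] at this

theorem eq_one_of_fix (h : IsStaircase ψ K) {f : thompsonF}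
    (hf : ∀ x ∈ K, h.lineAction f x = x) : f = 1 := by
  apply Subtype.ext
  apply OrderIso.ext
  funext y
  have hψ := apply_fibreLo h.mono h.surj (y : ℝ)
  have hmem : fibreLo ψ y ∈ K := by
    rw [h.mem_iff, hψ]
    refine ⟨y.2.1, y.2.2, ?_⟩
    rintro ⟨p, q, hp, hq, hpq⟩
    have h1 : ψ p ≤ y := hψ ▸ h.mono hp.le
    have h2 : y ≤ ψ q := hψ ▸ h.mono hq.le
    exact absurd (fibreLo_le h.mono h.surj (le_antisymm h1 (hpq ▸ h2))) (not_le.2 hp)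
  have := h.apply_lineAction f (fibreLo ψ y)
  rw [hf _ hmem, hψ, extendFun_of_mem _ y.2] at this
  exact Subtype.ext this.symm

/-- The action of Thompson's group on the plane, through the first coordinate. -/
noncomputable def planeAction (h : IsStaircase ψ K) : thompsonF →* ((ℝ × ℝ) ≃ₜ (ℝ × ℝ)) where
  toFun f := (h.lineAction f).toHomeomorph.prodCongr (Homeomorph.refl ℝ)
  map_one' := by
    ext1 p
    simp
  map_mul' f g := by
    ext1 p
    rw [map_mul]
    rfl

theorem planeAction_apply (h : IsStaircase ψ K) (f : thompsonF) (p : ℝ × ℝ) :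
    h.planeAction f p = (h.lineAction f p.1, p.2) := rfl

theorem planeAction_mem_iff (h : IsStaircase ψ K) (f : thompsonF) (p : ℝ × ℝ) :
    h.planeAction f p ∈ K ×ˢ ({0} : Set ℝ) ↔ p ∈ K ×ˢ ({0} : Set ℝ) := by
  rw [planeAction_apply, Set.mem_prod, Set.mem_prod, h.lineAction_mem_iff]

/-- The action of Thompson's group on the complement of `K × {0}`. -/
noncomputable def complAction (h : IsStaircase ψ K) :
    thompsonF →* HomeoPlus (K ×ˢ ({0} : Set ℝ))ᶜ where
  toFun f := ⟨(h.planeAction f).subtype fun p => not_congr (h.planeAction_mem_iff f p).symm,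
    isOrientationPreserving_of_fst _ (h.lineAction f) fun _ => rfl⟩
  map_one' := by
    apply Subtype.ext
    ext1 p
    apply Subtype.ext
    change h.planeAction 1 p = p
    rw [map_one]
    rfl
  map_mul' f g := by
    apply Subtype.ext
    ext1 p
    apply Subtype.ext
    change h.planeAction (f * g) p = h.planeAction f (h.planeAction g p)
    rw [map_mul]
    rfl

theorem complAction_apply (h : IsStaircase ψ K) (f : thompsonF)
    (p : ((K ×ˢ ({0} : Set ℝ))ᶜ : Set (ℝ × ℝ))) :
    (((h.complAction f : _ ≃ₜ _) p : ((K ×ˢ ({0} : Set ℝ))ᶜ : Set (ℝ × ℝ))) : ℝ × ℝ) =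
      h.planeAction f p := rfl

theorem mappingClass_complAction_injective (h : IsStaircase ψ K) (hK1 : K ⊆ Set.Icc (0 : ℝ) 1)
    (hK : ∀ a b : ℝ, a < b → ∃ x ∈ Set.Ioo a b, x ∉ K) :
    Function.Injective ((mappingClass (K ×ˢ ({0} : Set ℝ))ᶜ).comp h.complAction) := by
  have key : ∀ f : thompsonF, mappingClass (K ×ˢ ({0} : Set ℝ))ᶜ (h.complAction f) = 1 →
      ∀ q ∈ K, h.lineAction f q ≤ q := by
    intro f hf q hq
    by_contra! hlt
    obtain ⟨w, hw1, hw2⟩ : ∃ w, w < q ∧ ∀ u, w < u → q < h.lineAction f u := by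
      refine ⟨(h.lineAction f).symm q, (OrderIso.symm_apply_lt _).2 hlt, fun u hu => ?_⟩
      rwa [← OrderIso.symm_apply_lt]
    obtain ⟨u, hu, huK⟩ := hK w q hw1
    rw [← map_one (mappingClass _), mappingClass_eq_iff] at hf
    exact not_homotopic_id_of_fst (C := K ×ˢ ({0} : Set ℝ)) (fun p hp => hp.2) _
      (h.lineAction f) (fun _ => rfl) (u := u) (q := q) (v := 2) (fun hu' => huK hu'.1) ⟨hq, rfl⟩
      (fun h2 => by have := (hK1 h2.1).2; norm_num at this) hu.2
      (by have := (hK1 hq).2; linarith) (hw2 u hu.1) hf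
  rw [injective_iff_map_eq_one]
  intro f hf
  -- neither `f` nor its inverse moves a point of `K` to the right
  refine h.eq_one_of_fix fun q hq => le_antisymm (key f hf q hq) ?_
  have h1 := key f⁻¹ (by
    have := congrArg (·⁻¹) hf
    simpa using this) q hq
  have h2 := (h.lineAction f).monotone h1
  rwa [lineAction_inv_apply] at h2

theorem embedsThompson (h : IsStaircase ψ K) (hK1 : K ⊆ Set.Icc (0 : ℝ) 1)
    (hK : ∀ a b : ℝ, a < b → ∃ x ∈ Set.Ioo a b, x ∉ K) :
    EmbedsThompson (K ×ˢ ({0} : Set ℝ)) h.planeAction := by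
  refine ⟨?_, ?_, ?_, h.complAction, h.complAction_apply,
    h.mappingClass_complAction_injective hK1 hK⟩
  · intro f p hp
    rw [planeAction_apply, h.lineAction_of_notMem f fun h' => hp ⟨h', trivial⟩]
  · intro f
    ext p
    constructor
    · rintro ⟨p, hp, rfl⟩
      exact (h.planeAction_mem_iff f p).2 hp
    · intro hp
      refine ⟨(h.planeAction f).symm p, ?_, (h.planeAction f).apply_symm_apply p⟩
      rwa [← h.planeAction_mem_iff f, Homeomorph.apply_symm_apply]
  · intro f hf
    refine h.eq_one_of_fix fun x hx => ?_
    exact congrArg Prod.fst (hf (x, 0) ⟨hx, rfl⟩)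

end IsStaircase

/-! ### Staircases over Cantor sets -/

theorem exists_isDyadic_between {x y : ℝ} (h : x < y) : ∃ d, IsDyadic d ∧ x < d ∧ d < y := by
  obtain ⟨n, hn⟩ := exists_pow_lt_of_lt_one (show 0 < y - x by linarith)
    (show (1 / 2 : ℝ) < 1 by norm_num)
  rw [one_div, inv_pow] at hn
  have h2 : (0 : ℝ) < 2 ^ n := by positivity
  refine ⟨(⌊x * 2 ^ n⌋ + 1 : ℤ) / 2 ^ n, ⟨_, n, rfl⟩, ?_, ?_⟩
  · rw [lt_div_iff₀ h2]
    push_cast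
    exact Int.lt_floor_add_one _
  · rw [div_lt_iff₀ h2]
    push_cast
    have h3 := Int.floor_le (x * 2 ^ n)
    have h4 := mul_lt_mul_of_pos_right hn h2
    rw [inv_mul_cancel₀ h2.ne'] at h4
    linarith

theorem countable_isDyadic : {x : ℝ | IsDyadic x}.Countable := by
  refine (Set.countable_range fun z : ℤ × ℕ => (z.1 : ℝ) / 2 ^ z.2).mono ?_
  rintro x ⟨m, n, rfl⟩
  exact ⟨(m, n), rfl⟩

/-- The dyadic rationals in the open unit interval. -/
def openDyadic : Set ℝ := {y | 0 < y ∧ y < 1 ∧ IsDyadic y}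

/-- A monotone function that climbs from `0` at `m` to `1` at `M` becomes a staircase when it is
continued with slope one to both sides. Continuity and surjectivity come from the density of the
dyadic rationals among the values. -/
theorem isStaircase_of_monotone {K : Set ℝ} {s : ℝ → ℝ} {m M : ℝ} (hm0 : 0 ≤ m) (hM1 : M ≤ 1)
    (hK : K ⊆ Set.Icc m M) (hs : Monotone s) (s_m : ∀ x ≤ m, s x = 0)
    (s_M : ∀ x, M ≤ x → s x = 1)
    (hval : ∀ y ∈ openDyadic, ∃ x x', x < x' ∧ s x = y ∧ s x' = y)
    (hconst : ∀ x x', m ≤ x → x < x' → x' ≤ M → s x = s x' →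
      s x ∈ openDyadic ∧ ∀ c ∈ Set.Ioo x x', c ∉ K)
    (hgap : ∀ x, m ≤ x → x ≤ M → x ∉ K →
      ∃ p q, m ≤ p ∧ p < x ∧ x < q ∧ q ≤ M ∧ s p = s q) :
    IsStaircase (fun x => s x + min (x - m) 0 + max (x - M) 0) K := by
  have s0 : ∀ x, 0 ≤ s x := fun x => by
    rw [← s_m (min x m) (min_le_right _ _)]
    exact hs (min_le_left _ _)
  have s1 : ∀ x, s x ≤ 1 := fun x => by
    rw [← s_M (max x M) (le_max_right _ _)]
    exact hs (le_max_left _ _)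
  have hmM : m ≤ M := by
    by_contra! hc
    have := s_m m le_rfl
    rw [s_M m hc.le] at this
    exact one_ne_zero this
  set ψ : ℝ → ℝ := fun x => s x + min (x - m) 0 + max (x - M) 0 with hψ
  have ψ_lt : ∀ x < m, ψ x = x - m := by
    intro x hx
    simp only [hψ]
    rw [s_m x hx.le, min_eq_left (by linarith), max_eq_right (by linarith)]
    ring
  have ψ_gt : ∀ x, M < x → ψ x = 1 + (x - M) := by
    intro x hx
    simp only [hψ]
    rw [s_M x hx.le, min_eq_right (by linarith), max_eq_left (by linarith)]
    ring
  have ψ_mid : ∀ x, m ≤ x → x ≤ M → ψ x = s x := by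
    intro x h1 h2
    simp only [hψ]
    rw [min_eq_right (by linarith), max_eq_right (by linarith)]
    ring
  have ψ_of_Ioo : ∀ x, 0 < s x → s x < 1 → ψ x = s x := by
    intro x h0 h1
    apply ψ_mid
    · by_contra! hc
      exact h0.ne' (s_m x hc.le)
    · by_contra! hc
      exact h1.ne (s_M x hc.le)
  have mono : Monotone ψ := by
    intro x y hxy
    have := hs hxy
    simp only [hψ]
    gcongr
  have cont : Continuous ψ := by
    apply mono.continuous_of_denseRange
    rw [DenseRange, dense_iff_exists_between]
    intro p q hpq
    rcases lt_or_ge p 0 with hp | hp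
    · obtain ⟨y, hy1, hy2⟩ := exists_between (lt_min hpq hp)
      refine ⟨y, ⟨m + y, ?_⟩, hy1, hy2.trans_le (min_le_left _ _)⟩
      have := hy2.trans_le (min_le_right _ _)
      rw [ψ_lt _ (by linarith)]
      ring
    rcases lt_or_ge 1 q with hq | hq
    · obtain ⟨y, hy1, hy2⟩ := exists_between (max_lt hpq hq)
      refine ⟨y, ⟨M + (y - 1), ?_⟩, (le_max_left _ _).trans_lt hy1, hy2⟩
      have := (le_max_right _ _).trans_lt hy1
      rw [ψ_gt _ (by linarith)]
      ring
    · obtain ⟨d, hd, h1, h2⟩ := exists_isDyadic_between hpq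
      have hd0 : 0 < d := hp.trans_lt h1
      have hd1 : d < 1 := h2.trans_le hq
      obtain ⟨x, -, -, hx, -⟩ := hval d ⟨hd0, hd1, hd⟩
      refine ⟨d, ⟨x, ?_⟩, h1, h2⟩
      rw [ψ_of_Ioo x (by rwa [hx]) (by rwa [hx]), hx]
  have const : ∀ x x', x < x' → ψ x = ψ x' → m ≤ x ∧ x' ≤ M ∧ s x = s x' := by
    intro x x' hlt heq
    have hmx : m ≤ x := by
      by_contra! hc
      have h0 := s0 x'
      have h1 : x - m < min (x' - m) 0 := lt_min (by linarith) (by linarith)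
      have h2 := le_max_right (x' - M) 0
      rw [ψ_lt x hc] at heq
      simp only [hψ] at heq
      linarith
    have hxM : x' ≤ M := by
      by_contra! hc
      have h0 := s1 x
      have h1 : max (x - M) 0 < x' - M := max_lt (by linarith) (by linarith)
      have h2 := min_le_right (x - m) 0
      rw [ψ_gt x' hc] at heq
      simp only [hψ] at heq
      linarith
    rw [ψ_mid x hmx (hlt.le.trans hxM), ψ_mid x' (hmx.trans hlt.le) hxM] at heq
    exact ⟨hmx, hxM, heq⟩
  have mid : ∀ x, 0 ≤ ψ x → ψ x ≤ 1 → m ≤ x ∧ x ≤ M := by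
    intro x h0 h1
    constructor
    · by_contra! hc
      rw [ψ_lt x hc] at h0
      linarith
    · by_contra! hc
      rw [ψ_gt x hc] at h1
      linarith
  refine ⟨mono, ?_, ?_, ?_, ?_⟩
  · intro y
    refine mem_range_of_exists_le_of_exists_ge cont ⟨m + min y (-1), ?_⟩ ⟨M + max y 1, ?_⟩
    · rw [ψ_lt _ (by linarith [min_le_right y (-1)])]
      linarith [min_le_left y (-1)]
    · rw [ψ_gt _ (by linarith [le_max_right y 1])]
      linarith [le_max_left y 1]
  · intro y
    constructor
    · rintro ⟨x, x', hlt, h1, h2⟩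
      obtain ⟨hmx, hxM, heq⟩ := const x x' hlt (h1.trans h2.symm)
      rw [← h1, ψ_mid x hmx (hlt.le.trans hxM)]
      exact (hconst x x' hmx hlt hxM heq).1
    · intro hy
      obtain ⟨x, x', hlt, h1, h2⟩ := hval y hy
      refine ⟨x, x', hlt, ?_, ?_⟩
      · rw [ψ_of_Ioo x (by rw [h1]; exact hy.1) (by rw [h1]; exact hy.2.1), h1]
      · rw [ψ_of_Ioo x' (by rw [h2]; exact hy.1) (by rw [h2]; exact hy.2.1), h2]
  · intro x
    constructor
    · intro hx
      rw [ψ_mid x (hK hx).1 (hK hx).2]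
      refine ⟨s0 x, s1 x, ?_⟩
      rintro ⟨p, q, hp, hq, hpq⟩
      obtain ⟨hmp, hqM, heq⟩ := const p q (hp.trans hq) hpq
      exact (hconst p q hmp (hp.trans hq) hqM heq).2 x ⟨hp, hq⟩ hx
    · rintro ⟨h0, h1, hno⟩
      by_contra hx
      obtain ⟨hmx, hxM⟩ := mid x h0 h1
      obtain ⟨p, q, hmp, hp, hq, hqM, heq⟩ := hgap x hmx hxM hx
      refine hno ⟨p, q, hp, hq, ?_⟩
      rw [ψ_mid p hmp (hp.le.trans hxM), ψ_mid q (hmx.trans hq.le) hqM, heq]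
  · intro x h0 h1
    obtain ⟨hmx, hxM⟩ := mid x h0.le h1.le
    exact ⟨hm0.trans hmx, hxM.trans hM1⟩

/-- `(a, b)` is a bounded gap of `K`. -/
structure IsGap (K : Set ℝ) (a b : ℝ) : Prop where
  left_mem : a ∈ K
  right_mem : b ∈ K
  lt : a < b
  notMem : ∀ x ∈ Set.Ioo a b, x ∉ K

/-- The topological properties of Cantor sets in the line: they are nonempty, compact, without
isolated points, and contain no interval. -/
structure IsCantorInLine (K : Set ℝ) : Prop where
  nonempty : K.Nonempty
  isCompact : IsCompact K
  exists_ne : ∀ x ∈ K, ∀ p q, p < x → x < q → ∃ y ∈ K, y ≠ x ∧ p < y ∧ y < q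
  exists_notMem : ∀ a b : ℝ, a < b → ∃ x ∈ Set.Ioo a b, x ∉ K

namespace IsCantorInLine

variable {K : Set ℝ}

theorem exists_isGap_of_notMem (h : IsCantorInLine K) {p x q : ℝ} (hp : p ∈ K) (hq : q ∈ K)
    (hx : x ∉ K) (hpx : p < x) (hxq : x < q) :
    ∃ a b, IsGap K a b ∧ p ≤ a ∧ a < x ∧ x < b ∧ b ≤ q := by
  obtain ⟨a, ⟨haK, hax⟩, ha⟩ := (h.isCompact.inter_right isClosed_Iic).exists_isGreatest
    (⟨p, hp, hpx.le⟩ : (K ∩ Set.Iic x).Nonempty)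
  obtain ⟨b, ⟨hbK, hbx⟩, hb⟩ := (h.isCompact.inter_right isClosed_Ici).exists_isLeast
    (⟨q, hq, hxq.le⟩ : (K ∩ Set.Ici x).Nonempty)
  have hax' : a < x := lt_of_le_of_ne hax (fun h => hx (h ▸ haK))
  have hbx' : x < b := lt_of_le_of_ne hbx (fun h => hx (h ▸ hbK))
  refine ⟨a, b, ⟨haK, hbK, hax'.trans hbx', fun y hy hyK => ?_⟩, ha ⟨hp, hpx.le⟩, hax', hbx',
    hb ⟨hq, hxq.le⟩⟩
  rcases le_total y x with h | h
  · exact absurd (ha ⟨hyK, h⟩) (not_le.2 hy.1)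
  · exact absurd (hb ⟨hyK, h⟩) (not_le.2 hy.2)

/-- Every neighbourhood of a point of a Cantor set contains a gap. -/
theorem exists_isGap_near (h : IsCantorInLine K) {p c q : ℝ} (hc : c ∈ K) (hpc : p < c)
    (hcq : c < q) : ∃ a b, IsGap K a b ∧ p < a ∧ b < q := by
  obtain ⟨c', hc', hne, hpc', hcq'⟩ := h.exists_ne c hc p q hpc hcq
  rcases lt_or_gt_of_ne hne with hlt | hlt
  · obtain ⟨x, hx, hxK⟩ := h.exists_notMem _ _ hlt
    obtain ⟨a, b, hab, h1, -, -, h2⟩ := h.exists_isGap_of_notMem hc' hc hxK hx.1 hx.2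
    exact ⟨a, b, hab, hpc'.trans_le h1, h2.trans_lt hcq⟩
  · obtain ⟨x, hx, hxK⟩ := h.exists_notMem _ _ hlt
    obtain ⟨a, b, hab, h1, -, -, h2⟩ := h.exists_isGap_of_notMem hc hc' hxK hx.1 hx.2
    exact ⟨a, b, hab, hpc.trans_le h1, h2.trans_lt hcq'⟩

end IsCantorInLine

/-- The left end points of the bounded gaps of `K`. -/
def gapLeft (K : Set ℝ) : Set ℝ := {a | ∃ b, IsGap K a b}

theorem countable_gapLeft (K : Set ℝ) : (gapLeft K).Countable := by
  choose! b hb using fun (a : ℝ) (ha : a ∈ gapLeft K) => ha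
  refine Set.PairwiseDisjoint.countable_of_Ioo (y := b) ?_ (fun a ha => (hb a ha).lt)
  intro a ha a' ha' hne
  rw [Function.onFun, Set.disjoint_left]
  intro x hx hx'
  rcases lt_or_gt_of_ne hne with h | h
  · exact (hb a ha).notMem a' ⟨h, hx'.1.trans hx.2⟩ (hb a' ha').left_mem
  · exact (hb a' ha').notMem a ⟨h, hx.1.trans hx'.2⟩ (hb a ha).left_mem

/-- The gaps of a Cantor set are ordered like the dyadic rationals in the open unit interval, by
Cantor's theorem on countable dense orders. -/
theorem IsCantorInLine.nonempty_orderIso {K : Set ℝ} (h : IsCantorInLine K) :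
    Nonempty (gapLeft K ≃o openDyadic) := by
  have hD : ∀ x y : ℝ, 0 ≤ x → y ≤ 1 → x < y → ∃ d ∈ openDyadic, x < d ∧ d < y := by
    intro x y hx hy hxy
    obtain ⟨d, hd, h1, h2⟩ := exists_isDyadic_between hxy
    exact ⟨d, ⟨hx.trans_lt h1, h2.trans_le hy, hd⟩, h1, h2⟩
  have : Countable (gapLeft K) := (countable_gapLeft K).to_subtype
  have : Countable openDyadic :=
    (countable_isDyadic.mono fun x hx => hx.2.2 : openDyadic.Countable).to_subtype
  have : DenselyOrdered openDyadic := ⟨fun x y hxy => by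
    obtain ⟨d, hd, h1, h2⟩ := hD x y x.2.1.le y.2.2.1.le hxy
    exact ⟨⟨d, hd⟩, h1, h2⟩⟩
  have : NoMinOrder openDyadic := ⟨fun x => by
    obtain ⟨d, hd, h1, h2⟩ := hD 0 x le_rfl x.2.2.1.le x.2.1
    exact ⟨⟨d, hd⟩, h2⟩⟩
  have : NoMaxOrder openDyadic := ⟨fun x => by
    obtain ⟨d, hd, h1, h2⟩ := hD x 1 x.2.1.le le_rfl x.2.2.1
    exact ⟨⟨d, hd⟩, h1⟩⟩
  have : Nonempty openDyadic := by
    obtain ⟨d, hd, -⟩ := hD 0 1 le_rfl le_rfl zero_lt_one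
    exact ⟨⟨d, hd⟩⟩
  -- the gaps are dense, without first and last element, since end points of gaps are not isolated
  have : DenselyOrdered (gapLeft K) := ⟨fun ⟨a, b, hab⟩ ⟨a', b', hab'⟩ hlt => by
    have hlt' : a < a' := hlt
    have hba' : b ≤ a' := by
      by_contra hc
      exact hab.notMem a' ⟨hlt', not_le.1 hc⟩ hab'.left_mem
    obtain ⟨x, hx, hxK⟩ : ∃ x ∈ Set.Ioo b a', x ∉ K := by
      apply h.exists_notMem
      refine lt_of_le_of_ne hba' fun heq => ?_
      subst heq
      obtain ⟨y, hy, hne, h1, h2⟩ := h.exists_ne b hab.right_mem a b' hab.lt hab'.lt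
      rcases lt_or_gt_of_ne hne with hl | hl
      · exact hab.notMem y ⟨h1, hl⟩ hy
      · exact hab'.notMem y ⟨hl, h2⟩ hy
    obtain ⟨c, d, hcd, h1, h2, -, -⟩ :=
      h.exists_isGap_of_notMem hab.right_mem hab'.left_mem hxK hx.1 hx.2
    exact ⟨⟨c, d, hcd⟩, hab.lt.trans_le h1, h2.trans hx.2⟩⟩
  have : NoMinOrder (gapLeft K) := ⟨fun ⟨a, b, hab⟩ => by
    obtain ⟨y, hy, hne, -, h2⟩ := h.exists_ne a hab.left_mem (a - 1) b (by linarith) hab.lt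
    have hya : y < a := (lt_or_gt_of_ne hne).resolve_right fun h' => hab.notMem y ⟨h', h2⟩ hy
    obtain ⟨x, hx, hxK⟩ := h.exists_notMem _ _ hya
    obtain ⟨c, d, hcd, -, h1, -, -⟩ := h.exists_isGap_of_notMem hy hab.left_mem hxK hx.1 hx.2
    exact ⟨⟨c, d, hcd⟩, h1.trans hx.2⟩⟩
  have : NoMaxOrder (gapLeft K) := ⟨fun ⟨a, b, hab⟩ => by
    obtain ⟨y, hy, hne, h2, -⟩ := h.exists_ne b hab.right_mem a (b + 1) hab.lt (by linarith)
    have hya : b < y := (lt_or_gt_of_ne hne).resolve_left fun h' => hab.notMem y ⟨h2, h'⟩ hy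
    obtain ⟨x, hx, hxK⟩ := h.exists_notMem _ _ hya
    obtain ⟨c, d, hcd, h1, -, -, -⟩ := h.exists_isGap_of_notMem hab.right_mem hy hxK hx.1 hx.2
    exact ⟨⟨c, d, hcd⟩, hab.lt.trans_le h1⟩⟩
  have : Nonempty (gapLeft K) := by
    obtain ⟨c, hc⟩ := h.nonempty
    obtain ⟨a, b, hab, -⟩ := h.exists_isGap_near hc (sub_one_lt c) (lt_add_one c)
    exact ⟨⟨a, b, hab⟩⟩
  exact Order.iso_of_countable_dense _ _

/-- The staircase through the values of `e` on the gaps, constant outside the hull of `K`. -/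
noncomputable def gapStair {K : Set ℝ} (e : gapLeft K ≃o openDyadic) (x : ℝ) : ℝ :=
  sSup (insert 0 {y | ∃ a : gapLeft K, (a : ℝ) < x ∧ y = e a})

section GapStair

variable {K : Set ℝ} (e : gapLeft K ≃o openDyadic)

theorem bddAbove_gapStair (x : ℝ) :
    BddAbove (insert 0 {y : ℝ | ∃ a : gapLeft K, (a : ℝ) < x ∧ y = e a}) := by
  refine ⟨1, ?_⟩
  rintro y (rfl | ⟨a, -, rfl⟩)
  · exact zero_le_one
  · exact (e a).2.2.1.le

theorem gapStair_nonneg (x : ℝ) : 0 ≤ gapStair e x :=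
  le_csSup (bddAbove_gapStair e x) (Set.mem_insert _ _)

theorem gapStair_le {x c : ℝ} (hc : 0 ≤ c) (h : ∀ a : gapLeft K, (a : ℝ) < x → (e a : ℝ) ≤ c) :
    gapStair e x ≤ c := by
  refine csSup_le ⟨0, Set.mem_insert _ _⟩ ?_
  rintro y (rfl | ⟨a, ha, rfl⟩)
  · exact hc
  · exact h a ha

theorem gapStair_le_one (x : ℝ) : gapStair e x ≤ 1 :=
  gapStair_le e zero_le_one fun a _ => (e a).2.2.1.le

theorem le_gapStair_of_lt {x : ℝ} {a : gapLeft K} (h : (a : ℝ) < x) : (e a : ℝ) ≤ gapStair e x :=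
  le_csSup (bddAbove_gapStair e x) (Or.inr ⟨a, h, rfl⟩)

theorem gapStair_mono : Monotone (gapStair e) := fun _ _ hxy =>
  gapStair_le e (gapStair_nonneg e _) fun _ ha => le_gapStair_of_lt e (ha.trans_le hxy)

theorem le_gapStair_of_le {x : ℝ} {a : gapLeft K} (h : (a : ℝ) ≤ x) :
    (e a : ℝ) ≤ gapStair e x := by
  refine le_of_forall_lt fun y hy => ?_
  obtain ⟨d, hd, h1, h2⟩ := exists_isDyadic_between (max_lt hy (e a).2.1)
  have hd' : d ∈ openDyadic := ⟨(le_max_right _ _).trans_lt h1, h2.trans (e a).2.2.1, hd⟩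
  have hlt : e.symm ⟨d, hd'⟩ < a := by
    rw [e.symm_apply_lt]
    exact h2
  have := le_gapStair_of_lt e (x := x) (a := e.symm ⟨d, hd'⟩) (lt_of_lt_of_le hlt h)
  rw [e.apply_symm_apply] at this
  exact ((le_max_left _ _).trans_lt h1).trans_le this

theorem gapStair_eq_of_isGap {a b x : ℝ} (hab : IsGap K a b) (hax : a ≤ x) (hxb : x ≤ b) :
    gapStair e x = e ⟨a, b, hab⟩ := by
  apply le_antisymm
  · refine gapStair_le e (e _).2.1.le fun a' ha' => ?_
    have : a' ≤ ⟨a, b, hab⟩ := by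
      by_contra hc
      obtain ⟨b', hab'⟩ := a'.2
      exact hab.notMem a' ⟨not_le.1 hc, ha'.trans_le hxb⟩ hab'.left_mem
    exact e.monotone this
  · exact le_gapStair_of_le e hax

end GapStair

/-- Every Cantor set in the unit interval has a staircase. -/
theorem IsCantorInLine.exists_isStaircase {K : Set ℝ} (h : IsCantorInLine K)
    (hK1 : K ⊆ Set.Icc (0 : ℝ) 1) : ∃ ψ, IsStaircase ψ K := by
  obtain ⟨e⟩ := h.nonempty_orderIso
  obtain ⟨m, hmK, hm⟩ := h.isCompact.exists_isLeast h.nonempty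
  obtain ⟨M, hMK, hM⟩ := h.isCompact.exists_isGreatest h.nonempty
  have s_m : ∀ x ≤ m, gapStair e x = 0 := by
    intro x hx
    refine le_antisymm (gapStair_le e le_rfl ?_) (gapStair_nonneg e x)
    rintro ⟨a, b, hab⟩ ha
    exact absurd (hm hab.left_mem) (not_le.2 (ha.trans_le hx))
  have s_M : ∀ x, M ≤ x → gapStair e x = 1 := by
    intro x hx
    refine le_antisymm (gapStair_le_one e x) (le_of_forall_lt fun y hy => ?_)
    obtain ⟨d, hd, h1, h2⟩ := exists_isDyadic_between (max_lt hy zero_lt_one)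
    have hd' : d ∈ openDyadic := ⟨(le_max_right _ _).trans_lt h1, h2, hd⟩
    obtain ⟨b, hab⟩ := (e.symm ⟨d, hd'⟩).2
    have := le_gapStair_of_lt e (x := x) (a := e.symm ⟨d, hd'⟩)
      ((hab.lt.trans_le (hM hab.right_mem)).trans_le hx)
    rw [e.apply_symm_apply] at this
    exact ((le_max_left _ _).trans_lt h1).trans_le this
  refine ⟨_, isStaircase_of_monotone (hK1 hmK).1 (hK1 hMK).2 (fun x hx => ⟨hm hx, hM hx⟩)
    (gapStair_mono e) s_m s_M ?_ ?_ ?_⟩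
  · intro y hy
    obtain ⟨b, hab⟩ := (e.symm ⟨y, hy⟩).2
    have hy' := congrArg Subtype.val (e.apply_symm_apply ⟨y, hy⟩)
    exact ⟨e.symm ⟨y, hy⟩, b, hab.lt, (gapStair_eq_of_isGap e hab le_rfl hab.lt.le).trans hy',
      (gapStair_eq_of_isGap e hab hab.lt.le le_rfl).trans hy'⟩
  · intro x x' hmx hlt hxM heq
    have hno : ∀ c ∈ Set.Ioo x x', c ∉ K := by
      intro c hc hcK
      -- otherwise there are two gaps between `x` and `x'`, where the values differ
      obtain ⟨a, b, hab, h1, h2⟩ := h.exists_isGap_near hcK hc.1 hc.2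
      obtain ⟨a', b', hab', h3, h4⟩ := h.exists_isGap_near hab.right_mem hab.lt h2
      have e1 : gapStair e x ≤ e ⟨a, b, hab⟩ := by
        rw [← gapStair_eq_of_isGap e hab le_rfl hab.lt.le]
        exact gapStair_mono e h1.le
      have e2 : (e ⟨a', b', hab'⟩ : ℝ) ≤ gapStair e x' := by
        rw [← gapStair_eq_of_isGap e hab' le_rfl hab'.lt.le]
        exact gapStair_mono e (hab'.lt.trans h4).le
      have e3 : (e ⟨a, b, hab⟩ : ℝ) < e ⟨a', b', hab'⟩ := e.strictMono h3
      linarith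
    refine ⟨?_, hno⟩
    obtain ⟨z, hz⟩ := exists_between hlt
    obtain ⟨a, b, hab, -, haz, hzb, -⟩ := h.exists_isGap_of_notMem hmK hMK (hno z hz)
      (hmx.trans_lt hz.1) (hz.2.trans_le hxM)
    have hax : a ≤ x := by
      by_contra! hc
      exact hno a ⟨hc, haz.trans hz.2⟩ hab.left_mem
    rw [gapStair_eq_of_isGap e hab hax (hz.1.trans hzb).le]
    exact (e _).2
  · intro x hmx hxM hx
    obtain ⟨a, b, hab, hma, hax, hxb, hbM⟩ := h.exists_isGap_of_notMem hmK hMK hx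
      (lt_of_le_of_ne hmx fun h => hx (h ▸ hmK)) (lt_of_le_of_ne hxM fun h => hx (h ▸ hMK))
    exact ⟨a, b, hma, hax, hxb, hbM, by
      rw [gapStair_eq_of_isGap e hab le_rfl hab.lt.le,
        gapStair_eq_of_isGap e hab hab.lt.le le_rfl]⟩

/-- A subset of the line homeomorphic to the space of binary sequences is a Cantor set. -/
theorem isCantorInLine_of_homeomorph {K : Set ℝ} (φ : K ≃ₜ (ℕ → Bool)) : IsCantorInLine K := by
  refine ⟨⟨_, (φ.symm fun _ => true).2⟩, ?_, ?_, ?_⟩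
  · have : CompactSpace K := φ.symm.compactSpace
    exact isCompact_iff_compactSpace.2 this
  · intro x hx p q hp hq
    set f := φ ⟨x, hx⟩ with hf
    have hlim : Filter.Tendsto (fun n => Function.update f n (!f n)) Filter.atTop (𝓝 f) := by
      rw [tendsto_pi_nhds]
      intro k
      apply tendsto_const_nhds.congr'
      filter_upwards [Filter.eventually_gt_atTop k] with n hn
      rw [Function.update_of_ne hn.ne]
    have hlim2 : Filter.Tendsto (fun n => (φ.symm (Function.update f n (!f n)) : ℝ)) Filter.atTop
        (𝓝 x) := by
      have h1 := (continuous_subtype_val.comp φ.symm.continuous).continuousAt.tendsto.comp hlim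
      have h2 : (Subtype.val ∘ φ.symm) f = x := by simp [hf]
      rwa [h2] at h1
    obtain ⟨n, hn⟩ := (hlim2.eventually (Ioo_mem_nhds hp hq)).exists
    refine ⟨_, (φ.symm (Function.update f n (!f n))).2, fun heq => ?_, hn.1, hn.2⟩
    have h3 : φ.symm (Function.update f n (!f n)) = ⟨x, hx⟩ := Subtype.ext heq
    rw [Homeomorph.symm_apply_eq, ← hf] at h3
    have h4 := congrFun h3 n
    simp at h4
  · intro a b hab
    by_contra! hc
    have : TotallyDisconnectedSpace K := φ.symm.totallyDisconnectedSpace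
    have h1 := totallyDisconnectedSpace_subtype_iff.1 this (Set.Ioo a b) hc isPreconnected_Ioo
    obtain ⟨c, hc1⟩ := exists_between hab
    obtain ⟨d, hd⟩ := exists_between hc1.2
    exact hd.1.ne (h1 hc1 ⟨hc1.1.trans hd.1, hd.2⟩)

theorem IsCantorSetInUnitSegment.exists_eq_prod {C : Set (ℝ × ℝ)}
    (hC : IsCantorSetInUnitSegment C) :
    ∃ K : Set ℝ, C = K ×ˢ ({0} : Set ℝ) ∧ K ⊆ Set.Icc (0 : ℝ) 1 ∧ IsCantorInLine K := by
  obtain ⟨hsub, ⟨φ⟩⟩ := hC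
  have h0 : ∀ p ∈ C, p = (p.1, 0) := fun p hp => Prod.ext rfl (hsub hp).2
  let e : {x : ℝ | (x, (0 : ℝ)) ∈ C} ≃ₜ C :=
    { toFun := fun x => ⟨(x, 0), x.2⟩
      invFun := fun p => ⟨(p : ℝ × ℝ).1, by
        change ((p : ℝ × ℝ).1, (0 : ℝ)) ∈ C
        rw [← h0 p p.2]
        exact p.2⟩
      left_inv := fun x => rfl
      right_inv := fun p => Subtype.ext (h0 p p.2).symm
      continuous_toFun := by fun_prop
      continuous_invFun := by fun_prop }
  refine ⟨{x | (x, (0 : ℝ)) ∈ C}, ?_, fun x hx => (hsub hx).1,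
    isCantorInLine_of_homeomorph ((e.trans φ).trans cantorSetHomeomorphNatToBool)⟩
  ext p
  constructor
  · intro hp
    have := h0 p hp
    exact ⟨this ▸ hp, (hsub hp).2⟩
  · rintro ⟨h1, h2⟩
    rw [show p = (p.1, 0) from Prod.ext rfl h2]
    exact h1

theorem isCantorSetInUnitSegment_ternaryCantorSet : IsCantorSetInUnitSegment ternaryCantorSet := by
  refine ⟨Set.prod_mono cantorSet_subset_unitInterval le_rfl, ⟨?_⟩⟩
  exact
    { toFun := fun p => ⟨(p : ℝ × ℝ).1, p.2.1⟩
      invFun := fun x => ⟨((x : ℝ), 0), x.2, rfl⟩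
      left_inv := fun p => Subtype.ext (Prod.ext rfl p.2.2.symm)
      right_inv := fun x => rfl
      continuous_toFun := by fun_prop
      continuous_invFun := by fun_prop }

/-! ### The Cantor function -/

/-- Step functions increasing to the Cantor function. -/
noncomputable def cantorApprox : ℕ → ℝ → ℝ
  | 0, x => if 1 ≤ x then 1 else 0
  | n + 1, x => (cantorApprox n (3 * x) + cantorApprox n (3 * x - 2)) / 2

theorem cantorApprox_of_nonpos (n : ℕ) {x : ℝ} (hx : x ≤ 0) : cantorApprox n x = 0 := by
  induction n generalizing x with
  | zero => exact if_neg (by linarith)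
  | succ n ih => rw [cantorApprox, ih (by linarith), ih (by linarith)]; norm_num

theorem cantorApprox_of_one_le (n : ℕ) {x : ℝ} (hx : 1 ≤ x) : cantorApprox n x = 1 := by
  induction n generalizing x with
  | zero => exact if_pos hx
  | succ n ih => rw [cantorApprox, ih (by linarith), ih (by linarith)]; norm_num

theorem cantorApprox_mono (n : ℕ) : Monotone (cantorApprox n) := by
  induction n with
  | zero =>
    intro x y hxy
    simp only [cantorApprox]
    split_ifs <;> linarith
  | succ n ih =>
    intro x y hxy
    have h1 := ih (show 3 * x ≤ 3 * y by linarith)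
    have h2 := ih (show 3 * x - 2 ≤ 3 * y - 2 by linarith)
    rw [cantorApprox, cantorApprox]
    linarith

theorem cantorApprox_mem (n : ℕ) (x : ℝ) : 0 ≤ cantorApprox n x ∧ cantorApprox n x ≤ 1 := by
  constructor
  · rw [← cantorApprox_of_nonpos n (min_le_right x 0)]
    exact cantorApprox_mono n (min_le_left _ _)
  · rw [← cantorApprox_of_one_le n (le_max_right x 1)]
    exact cantorApprox_mono n (le_max_left _ _)

theorem monotone_cantorApprox (x : ℝ) : Monotone fun n => cantorApprox n x := by
  refine monotone_nat_of_le_succ fun n => ?_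
  induction n generalizing x with
  | zero =>
    by_cases h : 1 ≤ x
    · rw [cantorApprox_of_one_le 0 h, cantorApprox_of_one_le _ h]
    · rw [show cantorApprox 0 x = 0 from if_neg h]
      exact (cantorApprox_mem _ _).1
  | succ n ih =>
    have h1 := ih (3 * x)
    have h2 := ih (3 * x - 2)
    rw [cantorApprox, cantorApprox.eq_2 x (n + 1)]
    linarith

/-- The Cantor function. -/
noncomputable def cantorFun (x : ℝ) : ℝ := ⨆ n, cantorApprox n x

theorem tendsto_cantorApprox (x : ℝ) :
    Filter.Tendsto (fun n => cantorApprox n x) Filter.atTop (𝓝 (cantorFun x)) :=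
  tendsto_atTop_ciSup (monotone_cantorApprox x)
    ⟨1, by rintro _ ⟨n, rfl⟩; exact (cantorApprox_mem n x).2⟩

theorem cantorFun_eq (x : ℝ) : cantorFun x = (cantorFun (3 * x) + cantorFun (3 * x - 2)) / 2 := by
  have h1 := (tendsto_cantorApprox x).comp (Filter.tendsto_add_atTop_nat 1)
  have h2 := ((tendsto_cantorApprox (3 * x)).add (tendsto_cantorApprox (3 * x - 2))).div_const 2
  exact tendsto_nhds_unique h1 h2

theorem cantorFun_of_nonpos {x : ℝ} (hx : x ≤ 0) : cantorFun x = 0 := by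
  simp [cantorFun, cantorApprox_of_nonpos _ hx]

theorem cantorFun_of_one_le {x : ℝ} (hx : 1 ≤ x) : cantorFun x = 1 := by
  simp [cantorFun, cantorApprox_of_one_le _ hx]

theorem cantorFun_mono : Monotone cantorFun := fun x y hxy =>
  le_of_tendsto_of_tendsto' (tendsto_cantorApprox x) (tendsto_cantorApprox y)
    fun n => cantorApprox_mono n hxy

theorem cantorFun_nonneg (x : ℝ) : 0 ≤ cantorFun x :=
  ge_of_tendsto' (tendsto_cantorApprox x) fun n => (cantorApprox_mem n x).1

theorem cantorFun_le_one (x : ℝ) : cantorFun x ≤ 1 :=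
  le_of_tendsto' (tendsto_cantorApprox x) fun n => (cantorApprox_mem n x).2

theorem cantorFun_left {x : ℝ} (hx : x ≤ 2 / 3) : cantorFun x = cantorFun (3 * x) / 2 := by
  rw [cantorFun_eq, cantorFun_of_nonpos (show 3 * x - 2 ≤ 0 by linarith), add_zero]

theorem cantorFun_right {x : ℝ} (hx : 1 / 3 ≤ x) :
    cantorFun x = (1 + cantorFun (3 * x - 2)) / 2 := by
  rw [cantorFun_eq, cantorFun_of_one_le (show 1 ≤ 3 * x by linarith)]

theorem cantorFun_div_three {x : ℝ} (hx : x ≤ 1) : cantorFun (x / 3) = cantorFun x / 2 := by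
  rw [cantorFun_left (by linarith)]
  congr 2
  ring

theorem cantorFun_add_two_div_three {x : ℝ} (hx : 0 ≤ x) :
    cantorFun ((2 + x) / 3) = (1 + cantorFun x) / 2 := by
  rw [cantorFun_right (by linarith)]
  congr 3
  ring

theorem cantorFun_pos {x : ℝ} (hx : 0 < x) : 0 < cantorFun x := by
  have key : ∀ n : ℕ, ∀ x : ℝ, (1 / 3) ^ n ≤ x → 0 < cantorFun x := by
    intro n
    induction n with
    | zero =>
      intro x hx
      rw [cantorFun_of_one_le (by simpa using hx)]
      exact one_pos
    | succ n ih =>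
      intro x hx
      rw [pow_succ] at hx
      have h1 := ih (3 * x) (by linarith)
      have h2 := cantorFun_nonneg (3 * x - 2)
      rw [cantorFun_eq]
      linarith
  obtain ⟨n, hn⟩ := exists_pow_lt_of_lt_one hx (show (1 / 3 : ℝ) < 1 by norm_num)
  exact key n x hn.le

theorem cantorFun_lt_one {x : ℝ} (hx : x < 1) : cantorFun x < 1 := by
  have key : ∀ n : ℕ, ∀ x : ℝ, (1 / 3) ^ n ≤ 1 - x → cantorFun x < 1 := by
    intro n
    induction n with
    | zero =>
      intro x hx
      rw [cantorFun_of_nonpos (by rw [pow_zero] at hx; linarith)]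
      exact one_pos
    | succ n ih =>
      intro x hx
      rw [pow_succ] at hx
      have h1 := ih (3 * x - 2) (by linarith)
      have h2 := cantorFun_le_one (3 * x)
      rw [cantorFun_eq]
      linarith
  obtain ⟨n, hn⟩ := exists_pow_lt_of_lt_one (sub_pos.2 hx) (show (1 / 3 : ℝ) < 1 by norm_num)
  exact key n x hn.le

/-! ### The staircase of the middle-thirds Cantor set -/

/-- Every dyadic rational in `(0,1)` is taken by the Cantor function on a removed interval, by
induction on the denominator. -/
theorem exists_cantorFun_eq_of_isDyadic {y : ℝ} (hy : y ∈ openDyadic) :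
    ∃ x x', x < x' ∧ cantorFun x = y ∧ cantorFun x' = y := by
  obtain ⟨h0, h1, m, n, rfl⟩ := hy
  suffices key : ∀ n : ℕ, ∀ m : ℤ, 0 < (m : ℝ) / 2 ^ n → (m : ℝ) / 2 ^ n < 1 →
      ∃ x x', 0 ≤ x ∧ x < x' ∧ x' ≤ 1 ∧ cantorFun x = m / 2 ^ n ∧ cantorFun x' = m / 2 ^ n by
    obtain ⟨x, x', -, h, -, h'⟩ := key n m h0 h1
    exact ⟨x, x', h, h'⟩
  clear h0 h1 m n
  intro n
  induction n with
  | zero =>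
    intro m h0 h1
    rw [pow_zero, div_one] at h0 h1
    have h0' : 0 < m := by exact_mod_cast h0
    have h1' : m < 1 := by exact_mod_cast h1
    omega
  | succ n ih =>
    intro m h0 h1
    have e : (m : ℝ) / 2 ^ (n + 1) = (m : ℝ) / 2 ^ n / 2 := by rw [pow_succ]; field_simp
    have e2 : ((m - 2 ^ n : ℤ) : ℝ) / 2 ^ n = (m : ℝ) / 2 ^ n - 1 := by
      push_cast
      field_simp
    rw [e] at h0 h1 ⊢
    rcases lt_trichotomy ((m : ℝ) / 2 ^ n) 1 with h | h | h
    · obtain ⟨x, x', hx0, hlt, hx1, h2, h3⟩ := ih m (by linarith) h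
      refine ⟨x / 3, x' / 3, by linarith, by linarith, by linarith, ?_, ?_⟩
      · rw [cantorFun_div_three (by linarith), h2]
      · rw [cantorFun_div_three hx1, h3]
    · refine ⟨1 / 3, 2 / 3, by norm_num, by norm_num, by norm_num, ?_, ?_⟩
      · rw [cantorFun_div_three le_rfl, cantorFun_of_one_le le_rfl, h]
      · rw [show (2 / 3 : ℝ) = (2 + 0) / 3 by norm_num, cantorFun_add_two_div_three le_rfl,
          cantorFun_of_nonpos le_rfl, h]
        norm_num
    · obtain ⟨x, x', hx0, hlt, hx1, h2, h3⟩ := ih (m - 2 ^ n) (by rw [e2]; linarith)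
        (by rw [e2]; linarith)
      rw [e2] at h2 h3
      refine ⟨(2 + x) / 3, (2 + x') / 3, by linarith, by linarith, by linarith, ?_, ?_⟩
      · rw [cantorFun_add_two_div_three hx0, h2]
        ring
      · rw [cantorFun_add_two_div_three (by linarith), h3]
        ring

theorem mem_cantorSet_cases {z : ℝ} (hz : z ∈ cantorSet) :
    (z ≤ 1 / 3 ∧ 3 * z ∈ cantorSet) ∨ (2 / 3 ≤ z ∧ 3 * z - 2 ∈ cantorSet) := by
  rw [cantorSet_eq_union_halves] at hz
  rcases hz with ⟨w, hw, rfl⟩ | ⟨w, hw, rfl⟩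
  · have := cantorSet_subset_unitInterval hw
    refine Or.inl ⟨by simp only; linarith [this.2], ?_⟩
    simpa [mul_div_cancel₀] using hw
  · have := cantorSet_subset_unitInterval hw
    refine Or.inr ⟨by simp only; linarith [this.1], ?_⟩
    have e : 3 * ((2 + w) / 3) - 2 = w := by ring
    simpa [e] using hw

/-- The Cantor function is constant only on removed intervals: rescaling a pair of points with equal
values by `3` moves it apart until it lies in the middle third. -/
theorem cantorFun_const {x x' : ℝ} (h0 : 0 ≤ x) (hlt : x < x') (h1 : x' ≤ 1)
    (heq : cantorFun x = cantorFun x') :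
    cantorFun x ∈ openDyadic ∧ ∀ c ∈ Set.Ioo x x', c ∉ cantorSet := by
  have key : ∀ n : ℕ, ∀ x x' : ℝ, 0 ≤ x → (1 / 3) ^ n ≤ x' - x → x' ≤ 1 →
      cantorFun x = cantorFun x' →
      cantorFun x ∈ openDyadic ∧ ∀ c ∈ Set.Ioo x x', c ∉ cantorSet := by
    intro n
    induction n with
    | zero =>
      intro x x' h0 hd h1 heq
      rw [pow_zero] at hd
      rw [cantorFun_of_nonpos (by linarith), cantorFun_of_one_le (by linarith)] at heq
      exact absurd heq zero_ne_one
    | succ n ih =>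
      intro x x' h0 hd h1 heq
      have hpos : (0 : ℝ) < (1 / 3) ^ n := by positivity
      rw [pow_succ] at hd
      rcases le_or_gt x' (1 / 3) with hx' | hx'
      · have e1 := cantorFun_left (x := x) (by linarith)
        have e2 := cantorFun_left (x := x') (by linarith)
        obtain ⟨⟨g0, g1, m, k, hm⟩, hno⟩ := ih (3 * x) (3 * x') (by linarith) (by linarith)
          (by linarith) (by linarith)
        refine ⟨⟨by linarith, by linarith, m, k + 1, ?_⟩, fun c hc hcK => ?_⟩
        · rw [e1, hm, pow_succ]
          field_simp
        · rcases mem_cantorSet_cases hcK with ⟨-, h⟩ | ⟨h, -⟩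
          · exact hno (3 * c) ⟨by linarith [hc.1], by linarith [hc.2]⟩ h
          · linarith [hc.2]
      rcases le_or_gt (2 / 3) x with hx | hx
      · have e1 := cantorFun_right (x := x) (by linarith)
        have e2 := cantorFun_right (x := x') (by linarith)
        obtain ⟨⟨g0, g1, m, k, hm⟩, hno⟩ := ih (3 * x - 2) (3 * x' - 2) (by linarith)
          (by linarith) (by linarith) (by linarith)
        refine ⟨⟨by linarith, by linarith, 2 ^ k + m, k + 1, ?_⟩, fun c hc hcK => ?_⟩
        · rw [e1, hm, pow_succ]
          push_cast
          field_simp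
        · rcases mem_cantorSet_cases hcK with ⟨h, -⟩ | ⟨-, h⟩
          · linarith [hc.1]
          · exact hno (3 * c - 2) ⟨by linarith [hc.1], by linarith [hc.2]⟩ h
      · have e1 := cantorFun_left hx.le
        have e2 := cantorFun_right hx'.le
        have b1 := cantorFun_le_one (3 * x)
        have b2 := cantorFun_nonneg (3 * x' - 2)
        have c1 : 1 / 3 ≤ x := by
          by_contra! hc
          linarith [cantorFun_lt_one (x := 3 * x) (by linarith)]
        have c2 : x' ≤ 2 / 3 := by
          by_contra! hc
          linarith [cantorFun_pos (x := 3 * x' - 2) (by linarith)]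
        have hv : cantorFun x = 1 / 2 := by linarith
        refine ⟨by rw [hv]; exact ⟨by norm_num, by norm_num, 1, 1, by norm_num⟩,
          fun c hc hcK => ?_⟩
        rcases mem_cantorSet_cases hcK with ⟨h, -⟩ | ⟨h, -⟩
        · linarith [hc.1]
        · linarith [hc.2]
  obtain ⟨n, hn⟩ := exists_pow_lt_of_lt_one (sub_pos.2 hlt) (show (1 / 3 : ℝ) < 1 by norm_num)
  exact key n x x' h0 hn.le h1 heq

theorem exists_cantorFun_eq_of_notMem {x : ℝ} (h0 : 0 ≤ x) (h1 : x ≤ 1) (hx : x ∉ cantorSet) :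
    ∃ p q, 0 ≤ p ∧ p < x ∧ x < q ∧ q ≤ 1 ∧ cantorFun p = cantorFun q := by
  have key : ∀ n : ℕ, ∀ x : ℝ, 0 ≤ x → x ≤ 1 → x ∉ preCantorSet n →
      ∃ p q, 0 ≤ p ∧ p < x ∧ x < q ∧ q ≤ 1 ∧ cantorFun p = cantorFun q := by
    intro n
    induction n with
    | zero => intro x h0 h1 hx; exact absurd ⟨h0, h1⟩ hx
    | succ n ih =>
      intro x h0 h1 hx
      rw [preCantorSet_succ, Set.mem_union, not_or] at hx
      rcases le_or_gt x (1 / 3) with hx' | hx'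
      · obtain ⟨p, q, hp0, hp, hq, hq1, heq⟩ := ih (3 * x) (by linarith) (by linarith)
          fun h => hx.1 ⟨3 * x, h, by ring⟩
        refine ⟨p / 3, q / 3, by linarith, by linarith, by linarith, by linarith, ?_⟩
        rw [cantorFun_div_three (by linarith), cantorFun_div_three hq1, heq]
      rcases le_or_gt (2 / 3) x with hx'' | hx''
      · obtain ⟨p, q, hp0, hp, hq, hq1, heq⟩ := ih (3 * x - 2) (by linarith) (by linarith)
          fun h => hx.2 ⟨3 * x - 2, h, by ring⟩
        refine ⟨(2 + p) / 3, (2 + q) / 3, by linarith, by linarith, by linarith, by linarith, ?_⟩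
        rw [cantorFun_add_two_div_three hp0, cantorFun_add_two_div_three (by linarith), heq]
      · refine ⟨1 / 3, 2 / 3, by norm_num, hx', hx'', by norm_num, ?_⟩
        rw [cantorFun_div_three le_rfl, show (2 / 3 : ℝ) = (2 + 0) / 3 by norm_num,
          cantorFun_add_two_div_three le_rfl, cantorFun_of_nonpos le_rfl,
          cantorFun_of_one_le le_rfl]
        norm_num
  obtain ⟨n, hn⟩ : ∃ n, x ∉ preCantorSet n := by
    by_contra! hc
    exact hx (Set.mem_iInter.2 hc)
  exact key n x h0 h1 hn

/-- The Cantor function, continued with slope one. -/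
noncomputable def ternaryStair (x : ℝ) : ℝ := cantorFun x + min (x - 0) 0 + max (x - 1) 0

theorem isStaircase_ternaryStair : IsStaircase ternaryStair cantorSet :=
  isStaircase_of_monotone le_rfl le_rfl cantorSet_subset_unitInterval cantorFun_mono
    (fun _ => cantorFun_of_nonpos) (fun _ => cantorFun_of_one_le)
    (fun _ => exists_cantorFun_eq_of_isDyadic) (fun _ _ => cantorFun_const)
    (fun _ => exists_cantorFun_eq_of_notMem)

theorem ternaryStair_of_mem {x : ℝ} (hx : x ∈ Set.Icc (0 : ℝ) 1) :
    ternaryStair x = cantorFun x := by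
  rw [ternaryStair, min_eq_right (by linarith [hx.1]), max_eq_right (by linarith [hx.2])]
  ring

/-! ### Subdivisions adapted to elements of Thompson's group -/

theorem IsDyadic.eventually_mul_two_pow {x : ℝ} (hx : IsDyadic x) :
    ∀ᶠ n : ℕ in Filter.atTop, ∃ m : ℤ, x * 2 ^ n = m := by
  obtain ⟨m, k, rfl⟩ := hx
  filter_upwards [Filter.eventually_ge_atTop k] with n hn
  obtain ⟨l, rfl⟩ := Nat.exists_eq_add_of_le hn
  refine ⟨m * 2 ^ l, ?_⟩
  push_cast
  rw [pow_add]
  field_simp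

/-- An element of Thompson's group maps every interval of a sufficiently fine standard dyadic
subdivision affinely onto a standard dyadic interval. -/
theorem IsThompson.exists_subdivision {f : I ≃o I} (hf : IsThompson f) :
    ∃ n : ℕ, ∀ j : ℕ, j < 2 ^ n → ∃ m i : ℕ, i < 2 ^ m ∧
      ∀ t ∈ Set.Icc (0 : ℝ) 1, extendFun f ((j + t) / 2 ^ n) = (i + t) / 2 ^ m := by
  obtain ⟨D, hD, hB⟩ := id hf
  obtain ⟨N, hN⟩ := ((Filter.eventually_all_finset D).2 fun d hd =>
    (hD d hd).eventually_mul_two_pow).exists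
  have h2N : (0 : ℝ) < 2 ^ N := by positivity
  -- on each interval of the subdivision with denominator `2 ^ N`, the map is affine
  have hblock : ∀ j ∈ Finset.range (2 ^ N), ∀ᶠ l : ℕ in Filter.atTop, ∀ r : ℕ, r < 2 ^ l →
      ∃ (m : ℕ) (i : ℤ), ∀ t ∈ Set.Icc (0 : ℝ) 1,
        extendFun f ((j * 2 ^ l + r + t) / 2 ^ (N + l)) = (i + t) / 2 ^ m := by
    intro j hj
    have hj' : (j : ℝ) + 1 ≤ 2 ^ N := by exact_mod_cast Finset.mem_range.1 hj
    have hj0 : (0 : ℝ) ≤ j := Nat.cast_nonneg j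
    let a : I := ⟨j / 2 ^ N, by positivity, by rw [div_le_one h2N]; linarith⟩
    let b : I := ⟨(j + 1) / 2 ^ N, by positivity, by rw [div_le_one h2N]; linarith⟩
    have ha' : (a : ℝ) = j / 2 ^ N := rfl
    have hb' : (b : ℝ) = (j + 1) / 2 ^ N := rfl
    have hab : a < b := by
      change (j : ℝ) / 2 ^ N < (j + 1) / 2 ^ N
      gcongr
      linarith
    obtain ⟨k, hk⟩ := hB a b hab (by
      intro d hd hdab
      obtain ⟨m, hm⟩ := hN d hd
      have h1 : (j : ℝ) / 2 ^ N < d := hdab.1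
      have h2 : (d : ℝ) < (j + 1) / 2 ^ N := hdab.2
      rw [div_lt_iff₀ h2N, hm] at h1
      rw [lt_div_iff₀ h2N, hm] at h2
      have h1' : (j : ℤ) < m := by exact_mod_cast h1
      have h2' : m < (j : ℤ) + 1 := by exact_mod_cast h2
      omega)
    have hfa : IsDyadic (f a : ℝ) := (hf.dyadic_iff a).2 ⟨j, N, by simp [ha']⟩
    obtain ⟨p, q, hpq⟩ := hfa
    filter_upwards [Filter.eventually_ge_atTop (k.toNat + q)] with l hl r hr
    obtain ⟨m, hm⟩ : ∃ m : ℕ, (m : ℤ) = N + l - k := ⟨((N : ℤ) + l - k).toNat, by omega⟩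
    obtain ⟨s, hs⟩ : ∃ s : ℕ, m = q + s := Nat.exists_eq_add_of_le (by omega)
    refine ⟨m, p * 2 ^ s + r, fun t ht => ?_⟩
    have hr' : (r : ℝ) + 1 ≤ 2 ^ l := by exact_mod_cast hr
    have hr0 : (0 : ℝ) ≤ r := Nat.cast_nonneg r
    have h2l : (0 : ℝ) < 2 ^ l := by positivity
    have hx1 : (j : ℝ) / 2 ^ N ≤ (j * 2 ^ l + r + t) / 2 ^ (N + l) := by
      rw [pow_add, div_le_div_iff₀ h2N (by positivity)]
      have : 0 ≤ (r + t) * 2 ^ N := mul_nonneg (by linarith [ht.1]) h2N.le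
      linarith
    have hx2 : (j * 2 ^ l + r + t) / 2 ^ (N + l) ≤ ((j : ℝ) + 1) / 2 ^ N := by
      rw [pow_add, div_le_div_iff₀ (by positivity) h2N]
      have : 0 ≤ (2 ^ l - (r + t)) * 2 ^ N := mul_nonneg (by linarith [ht.2]) h2N.le
      linarith
    have hxI : (j * 2 ^ l + r + t) / 2 ^ (N + l) ∈ Set.Icc (0 : ℝ) 1 :=
      ⟨a.2.1.trans hx1, hx2.trans b.2.2⟩
    have hval := hk ⟨_, hxI⟩ ⟨hx1, hx2⟩
    rw [extendFun_of_mem _ hxI]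
    have e1 : (2 : ℝ) ^ k * 2 ^ m = 2 ^ (N + l) := by
      rw [← zpow_natCast, ← zpow_natCast, ← zpow_add₀ two_ne_zero]
      congr 1
      push_cast
      omega
    have e2 : (2 : ℝ) ^ m = 2 ^ q * 2 ^ s := by rw [hs, pow_add]
    have e3 : (j * 2 ^ l + r + t) / 2 ^ (N + l) - (j : ℝ) / 2 ^ N = (r + t) / 2 ^ (N + l) := by
      rw [pow_add]
      field_simp
      ring
    change (f ⟨_, hxI⟩ : ℝ) - f a = 2 ^ k * ((j * 2 ^ l + r + t) / 2 ^ (N + l) - j / 2 ^ N) at hval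
    rw [e3, hpq] at hval
    have e4 : (2 : ℝ) ^ k * ((r + t) / 2 ^ (N + l)) = (r + t) / 2 ^ m := by
      rw [← e1]
      field_simp
    have e5 : (p : ℝ) / 2 ^ q = p * 2 ^ s / 2 ^ m := by
      rw [e2]
      field_simp
    rw [e4, e5] at hval
    push_cast
    have e6 : ((p : ℝ) * 2 ^ s + r + t) / 2 ^ m = p * 2 ^ s / 2 ^ m + (r + t) / 2 ^ m := by ring
    rw [e6, ← hval]
    ring
  obtain ⟨l, hl⟩ := ((Filter.eventually_all_finset (Finset.range (2 ^ N))).2 hblock).exists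
  refine ⟨N + l, fun J hJ => ?_⟩
  have hj : J / 2 ^ l < 2 ^ N := by
    rw [Nat.div_lt_iff_lt_mul (by positivity), ← pow_add]
    exact hJ
  obtain ⟨m, i, hi⟩ := hl (J / 2 ^ l) (Finset.mem_range.2 hj) (J % 2 ^ l)
    (Nat.mod_lt _ (by positivity))
  have hJ' : ((J / 2 ^ l : ℕ) : ℝ) * 2 ^ l + ((J % 2 ^ l : ℕ) : ℝ) = J := by
    exact_mod_cast Nat.div_add_mod' J (2 ^ l)
  rw [hJ'] at hi
  have hJ1 : (J : ℝ) + 1 ≤ 2 ^ (N + l) := by exact_mod_cast hJ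
  have h2m : (0 : ℝ) < 2 ^ m := by positivity
  have hmem : ∀ t ∈ Set.Icc (0 : ℝ) 1, ((i : ℝ) + t) / 2 ^ m ∈ Set.Icc (0 : ℝ) 1 := by
    intro t ht
    rw [← hi t ht]
    apply extendFun_mem
    have h0 : (0 : ℝ) ≤ J := Nat.cast_nonneg J
    constructor
    · exact div_nonneg (by linarith [ht.1]) (by positivity)
    · rw [div_le_one (by positivity)]
      linarith [ht.2]
  have hi0 : 0 ≤ i := by
    have := (hmem 0 ⟨le_rfl, zero_le_one⟩).1
    rw [le_div_iff₀ h2m, zero_mul, add_zero] at this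
    exact_mod_cast this
  have hi1 : i + 1 ≤ 2 ^ m := by
    have := (hmem 1 ⟨zero_le_one, le_rfl⟩).2
    rw [div_le_one h2m] at this
    exact_mod_cast this
  obtain ⟨i, rfl⟩ := Int.eq_ofNat_of_zero_le hi0
  exact ⟨m, i, by exact_mod_cast hi1, fun t ht => by simpa using hi t ht⟩

/-! ### Self-similarity of the ternary staircase -/

/-- Over the `j`-th dyadic interval of length `2 ^ (-n)` the Cantor function is a copy of itself on
an interval of length `3 ^ (-n)`. -/
theorem exists_cantorFun_selfSimilar (n j : ℕ) (hj : j < 2 ^ n) : ∃ α : ℝ, 0 ≤ α ∧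
    α + 1 / 3 ^ n ≤ 1 ∧
    ∀ t ∈ Set.Icc (0 : ℝ) 1, cantorFun (α + t / 3 ^ n) = (j + cantorFun t) / 2 ^ n := by
  induction n generalizing j with
  | zero =>
    obtain rfl : j = 0 := by simpa using hj
    exact ⟨0, le_rfl, by norm_num, fun t _ => by simp⟩
  | succ n ih =>
    have h3 : (0 : ℝ) < 3 ^ n := by positivity
    have hbound : ∀ {α t : ℝ}, 0 ≤ α → α + 1 / 3 ^ n ≤ 1 → t ∈ Set.Icc (0 : ℝ) 1 →
        0 ≤ α + t / 3 ^ n ∧ α + t / 3 ^ n ≤ 1 := by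
      intro α t h0 h1 ht
      have e1 : 0 ≤ t / 3 ^ n := div_nonneg ht.1 h3.le
      have e2 : t / 3 ^ n ≤ 1 / 3 ^ n := div_le_div_of_nonneg_right ht.2 h3.le
      constructor <;> linarith
    rcases lt_or_ge j (2 ^ n) with hlt | hge
    · obtain ⟨α, h0, h1, h⟩ := ih j hlt
      refine ⟨α / 3, by linarith, ?_, fun t ht => ?_⟩
      · rw [pow_succ, ← div_div]
        linarith
      · have e : α / 3 + t / 3 ^ (n + 1) = (α + t / 3 ^ n) / 3 := by
          rw [pow_succ]
          field_simp
        rw [e, cantorFun_div_three (hbound h0 h1 ht).2, h t ht, pow_succ, div_div]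
    · obtain ⟨j, rfl⟩ := Nat.exists_eq_add_of_le hge
      obtain ⟨α, h0, h1, h⟩ := ih j (by rw [pow_succ] at hj; omega)
      refine ⟨(2 + α) / 3, by linarith, ?_, fun t ht => ?_⟩
      · rw [pow_succ, ← div_div]
        linarith
      · have e : (2 + α) / 3 + t / 3 ^ (n + 1) = (2 + (α + t / 3 ^ n)) / 3 := by
          rw [pow_succ]
          field_simp
          ring
        rw [e, cantorFun_add_two_div_three (hbound h0 h1 ht).1, h t ht, pow_succ]
        push_cast
        field_simp
        ring

/-- `t ↦ α + t / 3 ^ n` carries the unit interval onto the part of the staircase over the standard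
dyadic interval `[j / 2 ^ n, (j + 1) / 2 ^ n]`, compatibly with the self-similarity. -/
def IsTriadicChart (n j : ℕ) (α : ℝ) : Prop :=
  ∀ t ∈ Set.Icc (0 : ℝ) 1, ternaryStair (α + t / 3 ^ n) = (j + ternaryStair t) / 2 ^ n

theorem exists_isTriadicChart (n j : ℕ) (hj : j < 2 ^ n) : ∃ α, IsTriadicChart n j α := by
  obtain ⟨α, h0, h1, h⟩ := exists_cantorFun_selfSimilar n j hj
  refine ⟨α, fun t ht => ?_⟩
  have h3 : (0 : ℝ) < 3 ^ n := by positivity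
  have e1 : 0 ≤ t / 3 ^ n := div_nonneg ht.1 h3.le
  have e2 : t / 3 ^ n ≤ 1 / 3 ^ n := div_le_div_of_nonneg_right ht.2 h3.le
  rw [ternaryStair_of_mem ht, ternaryStair_of_mem ⟨by linarith, by linarith⟩, h t ht]

namespace IsTriadicChart

variable {n j : ℕ} {α : ℝ}

theorem exists_eq {z : ℝ} (h1 : α ≤ z) (h2 : z ≤ α + 1 / 3 ^ n) :
    ∃ t ∈ Set.Icc (0 : ℝ) 1, z = α + t / 3 ^ n := by
  have h3 : (0 : ℝ) < 3 ^ n := by positivity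
  refine ⟨(z - α) * 3 ^ n, ⟨mul_nonneg (by linarith) h3.le, ?_⟩, by field_simp; ring⟩
  rw [← le_div_iff₀ h3]
  linarith

theorem apply_left (h : IsTriadicChart n j α) : ternaryStair α = j / 2 ^ n := by
  have := h 0 ⟨le_rfl, zero_le_one⟩
  rwa [ternaryStair_of_mem ⟨le_rfl, zero_le_one⟩, cantorFun_of_nonpos le_rfl, zero_div, add_zero,
    add_zero] at this

theorem apply_right (h : IsTriadicChart n j α) : ternaryStair (α + 1 / 3 ^ n) = (j + 1) / 2 ^ n := by
  have := h 1 ⟨zero_le_one, le_rfl⟩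
  rwa [ternaryStair_of_mem ⟨zero_le_one, le_rfl⟩, cantorFun_of_one_le le_rfl] at this

theorem mem_of_apply {y z : ℝ} (h : IsTriadicChart n j α) (hy0 : j / 2 ^ n < y)
    (hy1 : y < (j + 1) / 2 ^ n) (hz : ternaryStair z = y) :
    ∃ t ∈ Set.Icc (0 : ℝ) 1, z = α + t / 3 ^ n := by
  apply exists_eq
  · exact (isStaircase_ternaryStair.mono.reflect_lt (by rwa [h.apply_left, hz])).le
  · exact (isStaircase_ternaryStair.mono.reflect_lt (by rwa [h.apply_right, hz])).le

theorem apply_pos {t : ℝ} (ht : 0 < t) (ht1 : t ≤ 1) : 0 < ternaryStair t := by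
  rw [ternaryStair_of_mem ⟨ht.le, ht1⟩]
  exact cantorFun_pos ht

theorem apply_lt_one {t : ℝ} (ht : 0 ≤ t) (ht1 : t < 1) : ternaryStair t < 1 := by
  rw [ternaryStair_of_mem ⟨ht, ht1.le⟩]
  exact cantorFun_lt_one ht1

theorem fibreHi_left (h : IsTriadicChart n j α) : fibreHi ternaryStair (j / 2 ^ n) = α := by
  have hS := isStaircase_ternaryStair
  apply le_antisymm
  · by_contra! hc
    have h3 : (0 : ℝ) < 3 ^ n := by positivity
    obtain ⟨z, hz1, hz2⟩ := exists_between (lt_min hc (show α < α + 1 / 3 ^ n by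
      linarith [show (0 : ℝ) < 1 / 3 ^ n by positivity]))
    obtain ⟨t, ht, rfl⟩ := exists_eq hz1.le (hz2.le.trans (min_le_right _ _))
    have ht0 : 0 < t := by
      by_contra! hc
      obtain rfl : t = 0 := le_antisymm hc ht.1
      simp at hz1
    have h4 := hS.mono (hz2.le.trans (min_le_left _ _))
    rw [apply_fibreHi hS.mono hS.surj, h t ht,
      div_le_div_iff_of_pos_right (by positivity)] at h4
    linarith [apply_pos ht0 ht.2]
  · exact le_fibreHi hS.mono hS.surj h.apply_left

theorem fibreLo_right (h : IsTriadicChart n j α) :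
    fibreLo ternaryStair ((j + 1) / 2 ^ n) = α + 1 / 3 ^ n := by
  have hS := isStaircase_ternaryStair
  apply le_antisymm
  · exact fibreLo_le hS.mono hS.surj h.apply_right
  · by_contra! hc
    have h3 : (0 : ℝ) < 3 ^ n := by positivity
    obtain ⟨z, hz1, hz2⟩ := exists_between (max_lt hc (show α < α + 1 / 3 ^ n by
      linarith [show (0 : ℝ) < 1 / 3 ^ n by positivity]))
    obtain ⟨t, ht, rfl⟩ := exists_eq ((le_max_right _ _).trans hz1.le) hz2.le
    have ht1 : t < 1 := by
      by_contra! hc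
      obtain rfl : t = 1 := le_antisymm ht.2 hc
      simp at hz2
    have h4 := hS.mono ((le_max_left _ _).trans hz1.le)
    rw [apply_fibreLo hS.mono hS.surj, h t ht,
      div_le_div_iff_of_pos_right (by positivity)] at h4
    linarith [apply_lt_one ht.1 ht1]

theorem fibre_bounds {t : ℝ} (ht0 : 0 < t) (ht1 : t < 1) :
    (j : ℝ) / 2 ^ n < (j + ternaryStair t) / 2 ^ n ∧
      (j + ternaryStair t) / 2 ^ n < ((j : ℝ) + 1) / 2 ^ n := by
  rw [div_lt_div_iff_of_pos_right (by positivity), div_lt_div_iff_of_pos_right (by positivity)]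
  constructor
  · linarith [apply_pos ht0 ht1.le]
  · linarith [apply_lt_one ht0.le ht1]

theorem eq_of_apply (h : IsTriadicChart n j α) {s t : ℝ} (hs : s ∈ Set.Icc (0 : ℝ) 1)
    (he : ternaryStair (α + s / 3 ^ n) = (j + ternaryStair t) / 2 ^ n) :
    ternaryStair s = ternaryStair t := by
  rw [h s hs] at he
  have h2 : (2 : ℝ) ^ n ≠ 0 := by positivity
  have := (div_left_inj' h2).1 he
  linarith

theorem fibre_mem {t : ℝ} (ht0 : 0 < t) (ht1 : t < 1) {s : ℝ}
    (hs : ternaryStair s = ternaryStair t) : s ∈ Set.Icc (0 : ℝ) 1 :=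
  isStaircase_ternaryStair.mem_Icc s (hs ▸ apply_pos ht0 ht1.le) (hs ▸ apply_lt_one ht0.le ht1)

theorem fibreLo_eq (h : IsTriadicChart n j α) {t : ℝ} (ht0 : 0 < t) (ht1 : t < 1) :
    fibreLo ternaryStair ((j + ternaryStair t) / 2 ^ n) =
      α + fibreLo ternaryStair (ternaryStair t) / 3 ^ n := by
  have hS := isStaircase_ternaryStair
  have hlo := apply_fibreLo hS.mono hS.surj (ternaryStair t)
  apply le_antisymm
  · apply fibreLo_le hS.mono hS.surj
    rw [h _ (fibre_mem ht0 ht1 hlo), hlo]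
  · have hz := apply_fibreLo hS.mono hS.surj ((j + ternaryStair t) / 2 ^ n)
    obtain ⟨s, hs, hs'⟩ := h.mem_of_apply (fibre_bounds ht0 ht1).1 (fibre_bounds ht0 ht1).2 hz
    rw [hs'] at hz ⊢
    have := fibreLo_le hS.mono hS.surj (h.eq_of_apply hs hz)
    gcongr

theorem fibreHi_eq (h : IsTriadicChart n j α) {t : ℝ} (ht0 : 0 < t) (ht1 : t < 1) :
    fibreHi ternaryStair ((j + ternaryStair t) / 2 ^ n) =
      α + fibreHi ternaryStair (ternaryStair t) / 3 ^ n := by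
  have hS := isStaircase_ternaryStair
  have hhi := apply_fibreHi hS.mono hS.surj (ternaryStair t)
  apply le_antisymm
  · have hz := apply_fibreHi hS.mono hS.surj ((j + ternaryStair t) / 2 ^ n)
    obtain ⟨s, hs, hs'⟩ := h.mem_of_apply (fibre_bounds ht0 ht1).1 (fibre_bounds ht0 ht1).2 hz
    rw [hs'] at hz ⊢
    have := le_fibreHi hS.mono hS.surj (h.eq_of_apply hs hz)
    gcongr
  · apply le_fibreHi hS.mono hS.surj
    rw [h _ (fibre_mem ht0 ht1 hhi), hhi]

end IsTriadicChart

/-- Where an element of Thompson's group maps a standard dyadic interval affinely onto another one,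
its lift is the affine map between the corresponding triadic intervals. -/
theorem lineAction_triadic {f : thompsonF} {n j m i : ℕ} {α β : ℝ} (hα : IsTriadicChart n j α)
    (hβ : IsTriadicChart m i β)
    (hf : ∀ t ∈ Set.Icc (0 : ℝ) 1, extendFun (f : I ≃o I) ((j + t) / 2 ^ n) = (i + t) / 2 ^ m)
    {t : ℝ} (ht : t ∈ Set.Icc (0 : ℝ) 1) :
    isStaircase_ternaryStair.lineAction f (α + t / 3 ^ n) = β + t / 3 ^ m := by
  have hS := isStaircase_ternaryStair
  rw [hS.lineAction_apply]
  rcases eq_or_lt_of_le ht.1 with rfl | ht0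
  -- the left end point is the right end of its own fibre
  · have hf0 := hf 0 ht
    rw [add_zero, add_zero] at hf0
    rw [zero_div, zero_div, add_zero, add_zero, liftFun, hα.apply_left, hf0, hα.fibreHi_left,
      hβ.fibreHi_left]
    have hnd := hS.fibreLo_lt_iff_extendFun f.2 (j / 2 ^ n)
    rw [hf0, hα.fibreHi_left, hβ.fibreHi_left] at hnd
    rcases eq_or_lt_of_le (hα.fibreHi_left ▸ fibreLo_le_fibreHi hS.mono hS.surj (j / 2 ^ n))
      with h1 | h1
    · have h2 := hβ.fibreHi_left ▸ fibreLo_le_fibreHi hS.mono hS.surj (i / 2 ^ m)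
      have h3 : ¬ fibreLo ternaryStair (i / 2 ^ m) < β := fun h => (hnd.2 h).ne h1
      rw [le_antisymm h2 (not_lt.1 h3)]
      simp
    · rw [div_self (by linarith)]
      ring
  rcases eq_or_lt_of_le ht.2 with rfl | ht1
  -- the right end point is the left end of its own fibre
  · rw [liftFun, hα.apply_right, hf 1 ht, hα.fibreLo_right, hβ.fibreLo_right]
    simp
  · have hψ : ternaryStair t ∈ Set.Icc (0 : ℝ) 1 :=
      ⟨(IsTriadicChart.apply_pos ht0 ht.2).le, (IsTriadicChart.apply_lt_one ht.1 ht1).le⟩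
    rw [liftFun, hα t ht, hf _ hψ, hα.fibreLo_eq ht0 ht1, hα.fibreHi_eq ht0 ht1,
      hβ.fibreLo_eq ht0 ht1, hβ.fibreHi_eq ht0 ht1]
    have h1 := fibreLo_le hS.mono hS.surj (rfl : ternaryStair t = ternaryStair t)
    have h2 := le_fibreHi hS.mono hS.surj (rfl : ternaryStair t = ternaryStair t)
    set lo := fibreLo ternaryStair (ternaryStair t)
    set hi := fibreHi ternaryStair (ternaryStair t)
    rcases eq_or_lt_of_le (h1.trans h2) with h3 | h3
    · rw [← h3, show lo = t by linarith]
      simp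
    · have h4 : hi - lo ≠ 0 := by linarith
      have e1 : α + hi / 3 ^ n - (α + lo / 3 ^ n) = (hi - lo) / 3 ^ n := by ring
      have e2 : α + t / 3 ^ n - (α + lo / 3 ^ n) = (t - lo) / 3 ^ n := by ring
      rw [e1, e2]
      field_simp
      ring

/-! ### Piecewise linearity -/

/-- A homeomorphism moving points horizontally by a map that is affine on finitely many closed
intervals covering the line is piecewise linear: the polyhedra are vertical strips. -/
theorem isPiecewiseLinear_of_fst (f : (ℝ × ℝ) ≃ₜ (ℝ × ℝ)) (G : ℝ → ℝ)
    (hf : ∀ p, f p = (G p.1, p.2)) (T : Set (Set ℝ)) (hT : T.Finite) (hcov : ∀ x, ∃ A ∈ T, x ∈ A)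
    (hA : ∀ A ∈ T, ((∃ a, A = Set.Iic a) ∨ (∃ a, A = Set.Ici a) ∨ ∃ a b, A = Set.Icc a b) ∧
      ∃ k l : ℝ, ∀ x ∈ A, G x = k * x + l) : IsPiecewiseLinear f := by
  classical
  refine ⟨(fun A => Prod.fst ⁻¹' A) '' T, ?_, ?_, ?_⟩
  · have : Finite ((fun A : Set ℝ => (Prod.fst ⁻¹' A : Set (ℝ × ℝ))) '' T) :=
      (hT.image _).to_subtype
    exact locallyFinite_of_finite _
  · refine Set.eq_univ_of_forall fun p => ?_
    obtain ⟨A, hAT, hpA⟩ := hcov p.1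
    exact ⟨_, ⟨A, hAT, rfl⟩, hpA⟩
  · rintro _ ⟨A, hAT, rfl⟩
    obtain ⟨hshape, k, l, hkl⟩ := hA A hAT
    constructor
    · rcases hshape with ⟨a, rfl⟩ | ⟨a, rfl⟩ | ⟨a, b, rfl⟩
      · refine ⟨{(LinearMap.fst ℝ ℝ ℝ, a)}, ?_⟩
        ext p
        simp
      · refine ⟨{(-LinearMap.fst ℝ ℝ ℝ, -a)}, ?_⟩
        ext p
        simp
      · refine ⟨{(-LinearMap.fst ℝ ℝ ℝ, -a), (LinearMap.fst ℝ ℝ ℝ, b)}, ?_⟩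
        ext p
        simp
    · refine ⟨((k • LinearMap.fst ℝ ℝ ℝ).prod (LinearMap.snd ℝ ℝ ℝ)).toAffineMap +
        AffineMap.const ℝ _ (l, 0), fun p hp => ?_⟩
      rw [hf, hkl p.1 hp]
      simp

theorem isPiecewiseLinear_planeAction_ternary (f : thompsonF) :
    IsPiecewiseLinear (isStaircase_ternaryStair.planeAction f) := by
  have hS := isStaircase_ternaryStair
  obtain ⟨n, hn⟩ := f.2.exists_subdivision
  have h2n : (0 : ℝ) < 2 ^ n := by positivity
  -- over each standard dyadic interval the pieces are the fibre over its left end point and the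
  -- triadic interval to the right of this fibre
  let A : ℕ → Set ℝ := fun j =>
    Set.Icc (fibreLo ternaryStair (j / 2 ^ n)) (fibreHi ternaryStair (j / 2 ^ n))
  let B : ℕ → Set ℝ := fun j =>
    Set.Icc (fibreHi ternaryStair (j / 2 ^ n)) (fibreLo ternaryStair ((j + 1) / 2 ^ n))
  have hout : ∀ x, x ∉ Set.Ioo (0 : ℝ) 1 → hS.lineAction f x = x := by
    intro x hx
    refine liftFun_of_fixed hS.mono hS.surj (extendFun_of_notMem_Ioo _ fun h => ?_)
    have hmem := hS.mem_Icc x h.1 h.2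
    rw [ternaryStair_of_mem hmem] at h
    refine hx ⟨?_, ?_⟩
    · by_contra! hc
      rw [cantorFun_of_nonpos hc] at h
      exact lt_irrefl _ h.1
    · by_contra! hc
      rw [cantorFun_of_one_le hc] at h
      exact lt_irrefl _ h.2
  refine isPiecewiseLinear_of_fst _ (hS.lineAction f) (hS.planeAction_apply f)
    ({Set.Iic 0, Set.Ici 1} ∪ (A '' Set.Iio (2 ^ n) ∪ B '' Set.Iio (2 ^ n))) ?_ ?_ ?_
  · exact ((Set.finite_singleton _).insert _).union
      (((Set.finite_Iio _).image _).union ((Set.finite_Iio _).image _))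
  · intro x
    rcases le_or_gt x 0 with h0 | h0
    · exact ⟨Set.Iic 0, by simp, h0⟩
    rcases le_or_gt 1 x with h1 | h1
    · exact ⟨Set.Ici 1, by simp, h1⟩
    have hy0 := IsTriadicChart.apply_pos h0 h1.le
    have hy1 := IsTriadicChart.apply_lt_one h0.le h1
    set y := ternaryStair x with hy
    set j := ⌊y * 2 ^ n⌋₊ with hj
    have hj1 : (j : ℝ) ≤ y * 2 ^ n := Nat.floor_le (by positivity)
    have hj2 : y * 2 ^ n < j + 1 := Nat.lt_floor_add_one _
    have hjn : j < 2 ^ n := by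
      have : (j : ℝ) < 2 ^ n := hj1.trans_lt (by
        have := mul_lt_mul_of_pos_right hy1 h2n
        linarith)
      exact_mod_cast this
    rcases eq_or_lt_of_le hj1 with heq | hlt
    · have hyj : y = j / 2 ^ n := by
        rw [heq]
        field_simp
      exact ⟨A j, Or.inr (Or.inl ⟨j, hjn, rfl⟩),
        fibreLo_le hS.mono hS.surj hyj, le_fibreHi hS.mono hS.surj hyj⟩
    · refine ⟨B j, Or.inr (Or.inr ⟨j, hjn, rfl⟩), ?_, ?_⟩
      · refine (hS.mono.reflect_lt ?_).le
        rwa [apply_fibreHi hS.mono hS.surj, div_lt_iff₀ h2n]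
      · refine (hS.mono.reflect_lt ?_).le
        rwa [apply_fibreLo hS.mono hS.surj, lt_div_iff₀ h2n]
  · rintro _ ((rfl | rfl) | ⟨j, hj, rfl⟩ | ⟨j, hj, rfl⟩)
    · exact ⟨Or.inl ⟨0, rfl⟩, 1, 0, fun x hx => by
        rw [hout x fun h => absurd hx (not_le.2 h.1)]
        ring⟩
    · exact ⟨Or.inr (Or.inl ⟨1, rfl⟩), 1, 0, fun x hx => by
        rw [hout x fun h => absurd hx (not_le.2 h.2)]
        ring⟩
    · refine ⟨Or.inr (Or.inr ⟨_, _, rfl⟩), ?_⟩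
      set y : ℝ := j / 2 ^ n
      set y' := extendFun (f : I ≃o I) y
      refine ⟨(fibreHi ternaryStair y' - fibreLo ternaryStair y') /
          (fibreHi ternaryStair y - fibreLo ternaryStair y),
        fibreLo ternaryStair y' - fibreLo ternaryStair y /
          (fibreHi ternaryStair y - fibreLo ternaryStair y) *
          (fibreHi ternaryStair y' - fibreLo ternaryStair y'), fun x hx => ?_⟩
      rw [hS.lineAction_apply, liftFun, apply_eq_of_mem_fibre hS.mono hS.surj hx.1 hx.2]
      ring
    · refine ⟨Or.inr (Or.inr ⟨_, _, rfl⟩), ?_⟩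
      obtain ⟨m, i, hi, hf⟩ := hn j hj
      obtain ⟨α, hα⟩ := exists_isTriadicChart n j hj
      obtain ⟨β, hβ⟩ := exists_isTriadicChart m i hi
      refine ⟨3 ^ n / 3 ^ m, β - α * 3 ^ n / 3 ^ m, fun x hx => ?_⟩
      change x ∈ Set.Icc _ _ at hx
      rw [hα.fibreHi_left, hα.fibreLo_right] at hx
      obtain ⟨t, ht, rfl⟩ := IsTriadicChart.exists_eq hx.1 hx.2
      rw [lineAction_triadic hα hβ hf ht]
      field_simp
      ring

theorem mainTheorem6 :
    (¬ VirtuallySolvable thompsonF ∧ ¬ ContainsNonabelianFree thompsonF) ∧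
    (∀ C : Set (ℝ × ℝ), IsCantorSetInUnitSegment C →
      (∃ ρ : thompsonF →* ((ℝ × ℝ) ≃ₜ (ℝ × ℝ)), EmbedsThompson C ρ) ∧
      ¬ ClassicalTitsAlternative (MappingClassGroup Cᶜ)) ∧
    IsCantorSetInUnitSegment ternaryCantorSet ∧
    (∃ ρ : thompsonF →* ((ℝ × ℝ) ≃ₜ (ℝ × ℝ)),
      EmbedsThompson ternaryCantorSet ρ ∧ ∀ g, IsPiecewiseLinear (ρ g)) := by
  refine ⟨⟨not_virtuallySolvable_thompsonF, not_containsNonabelianFree_thompsonF⟩, ?_,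
    isCantorSetInUnitSegment_ternaryCantorSet, ?_⟩
  · intro C hC
    obtain ⟨K, rfl, hK1, hK⟩ := hC.exists_eq_prod
    obtain ⟨ψ, hψ⟩ := hK.exists_isStaircase hK1
    have hE := hψ.embedsThompson hK1 hK.exists_notMem
    refine ⟨⟨_, hE⟩, ?_⟩
    obtain ⟨-, -, -, τ, -, hτ⟩ := hE
    exact not_classicalTitsAlternative_of_injective _ hτ not_virtuallySolvable_thompsonF
      not_containsNonabelianFree_thompsonF
  · have hK := isCantorInLine_of_homeomorph cantorSetHomeomorphNatToBool
    exact ⟨isStaircase_ternaryStair.planeAction,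
      isStaircase_ternaryStair.embedsThompson cantorSet_subset_unitInterval hK.exists_notMem,
      isPiecewiseLinear_planeAction_ternary⟩
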